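/- Let $d\ge 1$, $M\ge 2$, let $\mathbb T^d=\mathbb R^d/\mathbb Z^d$, let $\Pi:\mathbb R^d\to\mathbb T^d$ be the projection, let $\pi$ be Lebesgue (Haar probability) measure on $\mathbb T^d$, and for $x\in\mathbb T^d$ let $\check x\in[0,1)^d$ be its unique representative. **The map.** Let $\check E_1,\dots,\check E_M$ be a partition of $[0,1)^d$ into nondegenerate axis-aligned cubes (products of intervals of equal length, each with or without its endpoints; intervals if $d=1$). Let $p_i$ be the Lebesgue measure of $\check E_i$, and let $\check\varphi_i(\check x)=p_i^{-1/d}\check D_i\check x+\check e_i$ with $\check D_i$ an orthogonal matrix and $\check e_i\in\mathbb R^d$, such that $\check\varphi_i(\check E_i)\subseteq[0,1]^d$. Put $E_i=\Pi(\check E_i)$, $\varphi_i(x)=\Pi(\check\varphi_i(\check x))$, and let $\varphi:\mathbb T^d\to\mathbb T^d$ be given by $\varphi=\varphi_i$ on $E_i$. Assume: 1. each $\varphi_i:E_i\to\mathbb T^d$ is a bijection; 2. for every $\check x\in\partial[0,1]^d$ there are $i$ and $\check y\in(0,1)^d\cap\overline{\check E_i}$ with $\check\varphi_i(\check y)\equiv\check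 x \pmod{\mathbb Z^d}$; 3. if $d\ge2$, for every finite word $s=(s_0,\dots,s_{m-1})$ the cylinder set $\{x:\varphi^n(x)\in E_{s_n},\ 0\le n<m\}$ is, up to a Lebesgue null set, (the projection of) an axis-aligned cube. **The noise.** Let $\check K:\mathbb R^d\to\mathbb R$ satisfy $\check K(\check D_i\check x)=\check K(\check x)$ for all $i$ and $\check x$, and suppose one of the following holds. * (Gaussian) $\check K$ is the density of a Gaussian on $\mathbb R^d$ with mean $0$ and nondegenerate covariance matrix. * (Separated) $\check K$ is a probability density; for every $\eta>0$, $\inf_{\check x,\check y\in[0,\eta)^d}\check K(\check x-\check y)>0$; and there are a constant $A>0$ and probability densities $\check K_n$, $n\ge1$, on $\mathbb R^d$ with $\check K_n\to\check K$ in $L^1(\mathbb R^d)$ and $$\check K_n(\check x)=\sum_{i=1}^n b_{n,i}\prod_{j=1}^d\check k_{n,i}(\check x_j),\qquad b_{n,i}\ge0,$$ where each $\check k_{n,i}:\mathbb R\to\mathbb R$ is even, $t\mapsto|t|\check k_{n,i}(t)$ is integrable, and $$\int_{\mathbb R}\check k_{n,i}(t)\,dt=1,\qquad \int_{\mathbb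 R}|t|\,\check k_{n,i}(t)\,dt\le A,\qquad \int_0^{1/2}t\,\check k_{n,i}(t)\,dt\ge\frac1A .$$ For $\varepsilon>0$ let $K_\varepsilon(x)=\sum_{n\in\mathbb Z^d}\varepsilon^{-d}\check K\big((\check x+n)/\varepsilon\big)$, a probability density on $\mathbb T^d$, and let $X_{n+1}=\varphi(X_n)+\varepsilon\zeta_{n+1}$, where the $\varepsilon\zeta_n$ are independent with density $K_\varepsilon$ with respect to $\pi$, and independent of $X_0$. Let $$t_{\mathrm{mix}}=\min\Big\{n\in\mathbb N:\ \|\operatorname{dist}(X_n)-\pi\|_{\mathrm{TV}}\le\tfrac12\ \text{for all initial distributions of }X_0\Big\},\qquad \|\mu-\nu\|_{\mathrm{TV}}=\sup_{A}|\mu(A)-\nu(A)| ,$$ the supremum being over Borel sets $A$, with $t_{\mathrm{mix}}=\infty$ if there is no such $n$. **Theorem.** There is a constant $C$, independent of $\varepsilon$, such that $t_{\mathrm{mix}}\le C\,|\ln\varepsilon|$ for all sufficiently small $\varepsilon>0$. -/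

import Mathlib

open Set Filter Topology MeasureTheory
open scoped ENNReal Matrix

noncomputable section

namespace TorusMixing

/-! ### The torus -/

/-- The canonical projection `ℝᵈ → 𝕋ᵈ = ℝᵈ / ℤᵈ`. -/
def proj {d : ℕ} (x : Fin d → ℝ) : UnitAddTorus (Fin d) := fun j => (x j : UnitAddCircle)

/-- The unique representative in `[0, 1)ᵈ` of a point of the torus. -/
def rep {d : ℕ} (x : UnitAddTorus (Fin d)) : Fin d → ℝ :=
  fun j => (AddCircle.equivIco (1 : ℝ) 0 (x j) : ℝ)

/-- A nondegenerate axis-aligned cube: a product of intervals (each containing or omitting its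
endpoints) of a common positive length. For `d = 1` this is a bounded nondegenerate interval. -/
def IsAxisCube {d : ℕ} (Q : Set (Fin d → ℝ)) : Prop :=
  ∃ (a : Fin d → ℝ) (l : ℝ) (I : Fin d → Set ℝ), 0 < l ∧
    (∀ j, Ioo (a j) (a j + l) ⊆ I j ∧ I j ⊆ Icc (a j) (a j + l)) ∧ Q = Set.pi univ I

/-! ### Piecewise affine maps -/

/-- The data of a piecewise affine map: cells, linear parts (before scaling), translations. -/
structure PiecewiseAffine (d M : ℕ) where
  cell : Fin M → Set (Fin d → ℝ)
  rot : Fin M → Matrix (Fin d) (Fin d) ℝ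
  shift : Fin M → Fin d → ℝ

namespace PiecewiseAffine

variable {d M : ℕ} (B : PiecewiseAffine d M)

/-- The Lebesgue measure of the `i`-th cell. -/
def weight (i : Fin M) : ℝ := (volume (B.cell i)).toReal

/-- The affine map `x ↦ Dᵢ x / pᵢ^{1/d} + eᵢ`, on all of `ℝᵈ`. -/
def branch (i : Fin M) (x : Fin d → ℝ) : Fin d → ℝ :=
  (B.weight i ^ (1 / (d : ℝ)))⁻¹ • (B.rot i *ᵥ x) + B.shift i

/-- The cell on the torus. -/
def torusCell (i : Fin M) : Set (UnitAddTorus (Fin d)) := proj '' B.cell i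

/-- The `i`-th branch on the torus. -/
def torusBranch (i : Fin M) (x : UnitAddTorus (Fin d)) : UnitAddTorus (Fin d) :=
  proj (B.branch i (rep x))

/-- The map of the torus that is equal to the `i`-th branch on the `i`-th cell: when the cells
partition `[0, 1)ᵈ`, exactly one term of the sum is present. -/
def map (x : UnitAddTorus (Fin d)) : UnitAddTorus (Fin d) :=
  proj (∑ i, (B.cell i).indicator (B.branch i) (rep x))

/-- The cylinder set of a finite word `s`. The empty word gives the whole torus. -/
def cylinder (s : List (Fin M)) : Set (UnitAddTorus (Fin d)) :=
  {x | ∀ (n : ℕ) (h : n < s.length), B.map^[n] x ∈ B.torusCell s[n]}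

/-- A piecewise affine Bernoulli map: at least two cells, which are axis-aligned cubes and
partition `[0, 1)ᵈ`; each affine branch has an orthogonal linear part up to scaling and carries
its cell into the closed unit cube, bijectively onto the torus. -/
structure IsBernoulli : Prop where
  two_le : 2 ≤ M
  cell_cube : ∀ i, IsAxisCube (B.cell i)
  cell_disjoint : Pairwise fun i j => Disjoint (B.cell i) (B.cell j)
  cell_cover : ⋃ i, B.cell i = Set.pi univ fun _ => Ico (0 : ℝ) 1
  rot_orthogonal : ∀ i, B.rot i ∈ Matrix.orthogonalGroup (Fin d) ℝ
  branch_mapsTo : ∀ i, MapsTo (B.branch i) (B.cell i) (Set.pi univ fun _ => Icc (0 : ℝ) 1)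
  branch_bijOn : ∀ i, BijOn (B.torusBranch i) (B.torusCell i) univ

/-- The standing assumption on the map. Points of the boundary of the unit cube are read modulo
`ℤᵈ`, and cylinder sets are read modulo Lebesgue null sets (that is, up to faces). -/
structure CubeAssumption : Prop extends B.IsBernoulli where
  boundary_hit : ∀ x ∈ frontier (Set.pi univ fun _ : Fin d => Icc (0 : ℝ) 1),
    ∃ i, ∃ y ∈ closure (B.cell i), (∀ j, y j ∈ Ioo (0 : ℝ) 1) ∧ proj (B.branch i y) = proj x
  cylinder_cube : 2 ≤ d → ∀ s : List (Fin M), ∃ Q : Set (Fin d → ℝ),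
    IsAxisCube Q ∧ B.cylinder s =ᵐ[volume] proj '' Q

end PiecewiseAffine

/-! ### The noise -/

/-- The rescaled kernel `ε⁻ᵈ K(x / ε)`. -/
def rescale {d : ℕ} (K : (Fin d → ℝ) → ℝ) (ε : ℝ) (x : Fin d → ℝ) : ℝ :=
  (ε ^ d)⁻¹ * K (ε⁻¹ • x)

/-- The periodization of the rescaled kernel, a density on the torus. -/
def periodized {d : ℕ} (K : (Fin d → ℝ) → ℝ) (ε : ℝ) (x : UnitAddTorus (Fin d)) : ℝ≥0∞ :=
  ∑' n : Fin d → ℤ, ENNReal.ofReal (rescale K ε fun j => rep x j + n j)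

/-- The law of one noise increment. -/
def noiseLaw {d : ℕ} (K : (Fin d → ℝ) → ℝ) (ε : ℝ) : Measure (UnitAddTorus (Fin d)) :=
  volume.withDensity (periodized K ε)

/-- A probability density on `ℝᵈ`. -/
structure IsDensity {d : ℕ} (K : (Fin d → ℝ) → ℝ) : Prop where
  measurable : Measurable K
  nonneg : ∀ x, 0 ≤ K x
  integral_eq_one : ∫ x, K x = 1

/-- The density of the centred Gaussian on `ℝᵈ` with covariance matrix `S`. -/
def gaussianDensity {d : ℕ} (S : Matrix (Fin d) (Fin d) ℝ) (x : Fin d → ℝ) : ℝ :=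
  (Real.sqrt ((2 * Real.pi) ^ d * S.det))⁻¹ * Real.exp (-(x ⬝ᵥ (S⁻¹ *ᵥ x)) / 2)

/-- Invariance of the kernel under the orthogonal parts of the branches. -/
def RotInvariant {d M : ℕ} (B : PiecewiseAffine d M) (K : (Fin d → ℝ) → ℝ) : Prop :=
  ∀ i x, K (B.rot i *ᵥ x) = K x

/-- The kernel is a nondegenerate centred Gaussian density, invariant under the `Dᵢ`. -/
structure GaussianAssumption {d M : ℕ} (B : PiecewiseAffine d M) (K : (Fin d → ℝ) → ℝ) :
    Prop extends B.CubeAssumption where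
  gaussian : ∃ S : Matrix (Fin d) (Fin d) ℝ, S.PosDef ∧ K = gaussianDensity S
  invariant : RotInvariant B K

/-- The conditions on the one-dimensional factors: even, with total integral one, first absolute
moment at most `A`, and truncated first moment at least `1 / A`. -/
structure IsFactor (A : ℝ) (k : ℝ → ℝ) : Prop where
  even : Function.Even k
  integral_eq_one : ∫ t, k t = 1
  moment_integrable : Integrable fun t => |t| * k t
  moment_le : ∫ t, |t| * k t ≤ A
  le_moment : 1 / A ≤ ∫ t in (0 : ℝ)..(1 / 2), t * k t

/-- The kernel is a density, locally bounded below, which is an `L¹` limit of densities that are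
nonnegative combinations of products, and is invariant under the `Dᵢ`. -/
structure SeparatedAssumption {d M : ℕ} (B : PiecewiseAffine d M) (K : (Fin d → ℝ) → ℝ) :
    Prop extends B.CubeAssumption where
  density : IsDensity K
  lower : ∀ η : ℝ, 0 < η → ∃ c : ℝ, 0 < c ∧ ∀ x y : Fin d → ℝ,
    (∀ j, x j ∈ Ico 0 η) → (∀ j, y j ∈ Ico 0 η) → c ≤ K (x - y)
  separated : ∃ (Kn : ℕ → (Fin d → ℝ) → ℝ) (b : ℕ → ℕ → ℝ) (k : ℕ → ℕ → ℝ → ℝ) (A : ℝ),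
    0 < A ∧
    (∀ n, 1 ≤ n → IsDensity (Kn n)) ∧
    Tendsto (fun n => ∫⁻ x, ENNReal.ofReal |Kn n x - K x|) atTop (𝓝 0) ∧
    (∀ n, 1 ≤ n → ∀ x, Kn n x = ∑ i ∈ Finset.Icc 1 n, b n i * ∏ j, k n i (x j)) ∧
    (∀ n, 1 ≤ n → ∀ i ∈ Finset.Icc 1 n, 0 ≤ b n i ∧ IsFactor A (k n i))
  invariant : RotInvariant B K

/-! ### The Markov chain and its mixing time -/

/-- The law of `f X + ζ` when `X` and `ζ` are independent with laws `μ` and `ν`. -/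
def stepLaw {d : ℕ} (f : UnitAddTorus (Fin d) → UnitAddTorus (Fin d))
    (ν μ : Measure (UnitAddTorus (Fin d))) : Measure (UnitAddTorus (Fin d)) :=
  (μ.prod ν).map fun q => f q.1 + q.2

/-- The law of `X n` for the chain `X (n + 1) = f (X n) + ζ (n + 1)` started from `μ`, where the
`ζ n` are independent of each other and of `X 0`, with common law `ν`. -/
def chainLaw {d : ℕ} (f : UnitAddTorus (Fin d) → UnitAddTorus (Fin d))
    (ν μ : Measure (UnitAddTorus (Fin d))) (n : ℕ) : Measure (UnitAddTorus (Fin d)) :=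
  (stepLaw f ν)^[n] μ

/-- The total variation distance of probability measures, `sup |μ(A) - ν(A)|` over measurable
sets, which is half of the `L¹` distance of densities. -/
def tvDist {α : Type*} [MeasurableSpace α] (μ ν : Measure α) : ℝ≥0∞ :=
  ⨆ (s : Set α) (_ : MeasurableSet s), ENNReal.ofReal |(μ s).toReal - (ν s).toReal|

/-- The mixing time with threshold `δ`; it is `⊤` when the threshold is never reached. -/
def mixingTime {d : ℕ} (f : UnitAddTorus (Fin d) → UnitAddTorus (Fin d))
    (ν : Measure (UnitAddTorus (Fin d))) (δ : ℝ) : ℕ∞ :=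
  sInf ((fun n : ℕ => (n : ℕ∞)) '' {n : ℕ | ∀ μ : Measure (UnitAddTorus (Fin d)),
    IsProbabilityMeasure μ → tvDist (chainLaw f ν μ n) volume ≤ ENNReal.ofReal δ})

end TorusMixing

end

/-! Doeblin's argument, with the expansion of the map carrying a uniform component from scale `ε` to
scale one in about `log (1 / ε)` steps.

Two properties of the kernel drive it: a linear tail bound, mass at most `b / r` outside the ball of
radius `r`, and a positive lower bound on bounded sets. After one step from `x`, the lower bound
gives a density of order `ε⁻ᵈ` on a ball of radius of order `ε` about `φ x`. By `exists_word`, the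
point `φ x` lies in the closed cube of a word `s` whose expansion factor `W` is of order `1 / ε`;
that cube has diameter of order `ε`, so it lies in the ball.

Lebesgue measure on this cube is then pushed along `s` (`chainLaw_wordCube_ge`). Fix `1 < μ < λ`,
where `λ` is the least expansion factor, and allow noise of size at most `ε * r * μ ^ k` at step
`k`. The failure probabilities sum to at most a constant over `r`. The remaining branches magnify
that noise by at most `W / λ ^ (k + 1)`, so the displacements, seen at the unit scale, sum to at
most `√d / (λ - μ) * W * ε * r`. Taking `r` large and then `W * ε` small makes both totals small.
The factor `W⁻ᵈ` lost to spreading cancels `ε⁻ᵈ`, leaving a fixed multiple of Lebesgue measure on a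
slightly shrunken unit cube.

Words have different lengths, but Lebesgue measure is stationary, so this component can be run on to
a common time `n + 1` with an error equal to the mass of the removed layer. The result is
`Minorized`: domination of `c` times Lebesgue measure up to an additive `c / 4`. This error is small
enough for oscillations to contract by `1 - c / 2`, and boundedly many blocks of `n + 1` steps
suffice. -/

noncomputable section

namespace TorusMixing

/-! ### The torus as a quotient of Euclidean space -/

section Torus

variable {d : ℕ}

/-- The half-open unit cube, a fundamental domain for `ℤᵈ`. -/
abbrev halfOpenCube (d : ℕ) : Set (Fin d → ℝ) := Set.pi univ fun _ => Ico (0 : ℝ) 1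

/-- The closed unit cube. -/
abbrev closedCube (d : ℕ) : Set (Fin d → ℝ) := Set.pi univ fun _ => Icc (0 : ℝ) 1

/-- The open unit cube. -/
abbrev openCube (d : ℕ) : Set (Fin d → ℝ) := Set.pi univ fun _ => Ioo (0 : ℝ) 1

lemma measurableSet_halfOpenCube : MeasurableSet (halfOpenCube d) :=
  MeasurableSet.univ_pi fun _ => measurableSet_Ico

lemma continuous_proj : Continuous (proj : (Fin d → ℝ) → UnitAddTorus (Fin d)) :=
  continuous_pi fun j => (AddCircle.continuous_mk' 1).comp (continuous_apply j)

lemma measurable_proj : Measurable (proj : (Fin d → ℝ) → UnitAddTorus (Fin d)) :=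
  continuous_proj.measurable

lemma measurable_rep : Measurable (rep : UnitAddTorus (Fin d) → Fin d → ℝ) := by
  refine measurable_pi_lambda _ fun j => ?_
  exact measurable_subtype_coe.comp
    ((AddCircle.measurableEquivIco (1 : ℝ) 0).measurable.comp (measurable_pi_apply j))

lemma proj_add (x y : Fin d → ℝ) : proj (x + y) = proj x + proj y := by
  funext j
  simp [proj]

lemma proj_rep (x : UnitAddTorus (Fin d)) : proj (rep x) = x := by
  funext j
  exact (AddCircle.equivIco (1 : ℝ) 0).symm_apply_apply (x j)

lemma rep_mem (x : UnitAddTorus (Fin d)) : rep x ∈ halfOpenCube d := by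
  intro j _
  have h := (AddCircle.equivIco (1 : ℝ) 0 (x j)).2
  exact ⟨h.1, h.2.trans_eq (zero_add 1)⟩

lemma rep_proj {x : Fin d → ℝ} (hx : x ∈ halfOpenCube d) : rep (proj x) = x := by
  funext j
  have hj : x j ∈ Ico (0 : ℝ) (0 + 1) := by simpa using hx j (mem_univ j)
  have := (AddCircle.equivIco (1 : ℝ) 0).apply_symm_apply ⟨x j, hj⟩
  exact congrArg Subtype.val this

lemma proj_add_intCast (x : Fin d → ℝ) (n : Fin d → ℤ) : proj (fun j => x j + n j) = proj x := by
  funext j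
  simp only [proj, AddCircle.coe_add, add_eq_left]
  rw [AddCircle.coe_eq_zero_iff]
  exact ⟨n j, by simp⟩

/-- Points of the closed and of the open cube that agree modulo `ℤᵈ` are equal. -/
lemma eq_of_proj_eq {x y : Fin d → ℝ} (hx : x ∈ closedCube d) (hy : y ∈ openCube d)
    (h : proj x = proj y) : x = y := by
  funext j
  have hj : ((x j : ℝ) : UnitAddCircle) = (y j : ℝ) := congrFun h j
  rw [← sub_eq_zero, ← AddCircle.coe_sub, AddCircle.coe_eq_zero_iff] at hj
  obtain ⟨n, hn⟩ := hj
  have h1 := hx j (mem_univ j)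
  have h2 := hy j (mem_univ j)
  simp only [mem_Icc, mem_Ioo, zsmul_eq_mul, mul_one] at h1 h2 hn
  have hlt : (n : ℝ) < 1 := by linarith
  have hgt : (-1 : ℝ) < n := by linarith
  have hn0 : n = 0 := by
    have : n < 1 := by exact_mod_cast hlt
    have : -1 < n := by exact_mod_cast hgt
    omega
  subst hn0
  simp at hn
  linarith

instance : IsProbabilityMeasure (volume : Measure UnitAddCircle) := ⟨UnitAddCircle.measure_univ⟩

instance : IsProbabilityMeasure (volume : Measure (UnitAddTorus (Fin d))) :=
  inferInstanceAs (IsProbabilityMeasure (Measure.pi fun _ : Fin d => (volume : Measure UnitAddCircle)))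

lemma map_proj_halfOpenCube :
    (volume.restrict (halfOpenCube d)).map proj = (volume : Measure (UnitAddTorus (Fin d))) := by
  have h1 : MeasurePreserving (fun x : ℝ => (x : UnitAddCircle))
      (volume.restrict (Ico (0 : ℝ) 1)) volume := by
    have := AddCircle.measurePreserving_mk 1 0
    rw [zero_add, ← restrict_Ico_eq_restrict_Ioc] at this
    exact this
  have h2 := measurePreserving_pi (fun _ : Fin d => volume.restrict (Ico (0 : ℝ) 1))
    (fun _ => (volume : Measure UnitAddCircle)) fun _ => h1
  rw [← Measure.restrict_pi_pi] at h2
  exact h2.map_eq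

/-- Lebesgue measure on a subset of `ℝᵈ`, pushed to the torus. -/
def projMeasure (A : Set (Fin d → ℝ)) : Measure (UnitAddTorus (Fin d)) :=
  (volume.restrict A).map proj

lemma lintegral_projMeasure {A : Set (Fin d → ℝ)} {g : UnitAddTorus (Fin d) → ℝ≥0∞}
    (hg : Measurable g) : ∫⁻ x, g x ∂(projMeasure A) = ∫⁻ a in A, g (proj a) :=
  lintegral_map hg measurable_proj

lemma volume_eq_projMeasure :
    (volume : Measure (UnitAddTorus (Fin d))) = projMeasure (halfOpenCube d) :=
  map_proj_halfOpenCube.symm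

lemma projMeasure_univ (A : Set (Fin d → ℝ)) : projMeasure A univ = volume A := by
  rw [projMeasure, Measure.map_apply measurable_proj MeasurableSet.univ]
  simp

/-- Integration over `ℝᵈ` by summation over the translates of the unit cube. -/
lemma lintegral_eq_tsum_cube {h : (Fin d → ℝ) → ℝ≥0∞} (hh : Measurable h) :
    ∫⁻ y, h y = ∫⁻ y in halfOpenCube d, ∑' n : Fin d → ℤ, h fun j => y j + n j := by
  have hmeas : ∀ n : Fin d → ℤ, Measurable fun y : Fin d → ℝ => fun j => y j + (n j : ℝ) := by
    intro n
    fun_prop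
  rw [lintegral_tsum fun n => (show Measurable fun y : Fin d → ℝ => h fun j => y j + (n j : ℝ) from
    hh.comp (hmeas n)).aemeasurable]
  -- The translate of the unit cube by `n`, equivalently the set of points whose vector of integer
  -- parts is `n`.
  set S : (Fin d → ℤ) → Set (Fin d → ℝ) := fun n => {y | (fun j => y j - (n j : ℝ)) ∈ halfOpenCube d}
  have hSm : ∀ n, MeasurableSet (S n) := fun n =>
    (show Measurable fun y : Fin d → ℝ => fun j => y j - (n j : ℝ) by fun_prop)
      measurableSet_halfOpenCube
  have hmem : ∀ n y, y ∈ S n ↔ ∀ j, ⌊y j⌋ = n j := by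
    intro n y
    simp only [S, mem_ofPred_eq, halfOpenCube, mem_univ_pi, mem_Ico, Int.floor_eq_iff]
    exact forall_congr' fun j => by constructor <;> rintro ⟨h1, h2⟩ <;> constructor <;> linarith
  have hdisj : Pairwise (Function.onFun Disjoint S) := by
    intro n m hnm
    refine Set.disjoint_left.2 fun y hy hy' => hnm ?_
    funext j
    rw [← (hmem n y).1 hy j, (hmem m y).1 hy' j]
  have hcov : (⋃ n, S n) = univ := by
    refine eq_univ_of_forall fun y => mem_iUnion.2 ⟨fun j => ⌊y j⌋, ?_⟩
    rw [hmem]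
    exact fun _ => rfl
  rw [← setLIntegral_univ, ← hcov, lintegral_iUnion hSm hdisj]
  congr 1
  funext n
  rw [← lintegral_indicator (hSm n), ← lintegral_indicator measurableSet_halfOpenCube,
    ← lintegral_add_right_eq_self _ (fun j => (n j : ℝ))]
  congr 1
  funext y
  by_cases hy : y ∈ halfOpenCube d
  · rw [indicator_of_mem hy, indicator_of_mem]
    · rfl
    · simpa [S, mem_ofPred_eq] using hy
  · rw [indicator_of_notMem hy, indicator_of_notMem]
    simpa [S, mem_ofPred_eq] using hy

end Torus

/-! ### The noise as a projected measure -/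

section Noise

variable {d : ℕ}

/-- The measure on `ℝᵈ` with density `K`. -/
def kernelMeasure (K : (Fin d → ℝ) → ℝ) : Measure (Fin d → ℝ) :=
  volume.withDensity fun x => ENNReal.ofReal (K x)

lemma lintegral_kernelMeasure {K : (Fin d → ℝ) → ℝ} (hK : Measurable K)
    {g : (Fin d → ℝ) → ℝ≥0∞} (hg : Measurable g) :
    ∫⁻ z, g z ∂(kernelMeasure K) = ∫⁻ z, ENNReal.ofReal (K z) * g z :=
  lintegral_withDensity_eq_lintegral_mul _ hK.ennreal_ofReal hg

lemma isProbabilityMeasure_kernelMeasure {K : (Fin d → ℝ) → ℝ} (hK : IsDensity K) :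
    IsProbabilityMeasure (kernelMeasure K) := by
  constructor
  have hint : Integrable K := by
    by_contra hn
    simpa [integral_undef hn] using hK.integral_eq_one
  rw [kernelMeasure, withDensity_apply _ MeasurableSet.univ, setLIntegral_univ,
    ← ofReal_integral_eq_lintegral_ofReal hint (ae_of_all _ hK.nonneg), hK.integral_eq_one,
    ENNReal.ofReal_one]

/-- Rescaling of Lebesgue integrals on `ℝᵈ`. -/
lemma lintegral_comp_smul {ε : ℝ} (hε : 0 < ε) {h : (Fin d → ℝ) → ℝ≥0∞} (hh : Measurable h) :
    ∫⁻ z, h (ε • z) = ENNReal.ofReal (ε ^ d)⁻¹ * ∫⁻ y, h y := by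
  have h1 := Measure.map_addHaar_smul (volume : Measure (Fin d → ℝ)) hε.ne'
  rw [← lintegral_map (f := h) (g := fun z : Fin d → ℝ => ε • z) hh (measurable_const_smul ε), h1,
    lintegral_smul_measure, Module.finrank_fin_fun, abs_of_pos (by positivity), smul_eq_mul]

/-- The noise on the torus is the projection of the scaled noise on `ℝᵈ`. -/
lemma noiseLaw_eq_map {K : (Fin d → ℝ) → ℝ} (hK : Measurable K) {ε : ℝ} (hε : 0 < ε) :
    noiseLaw K ε = (kernelMeasure K).map fun z => proj (ε • z) := by
  have hres : Measurable fun y : Fin d → ℝ => ENNReal.ofReal (rescale K ε y) := by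
    unfold rescale
    fun_prop
  have hper : Measurable (periodized K ε) := by
    refine Measurable.tsum fun n => ?_
    exact hres.comp (measurable_pi_lambda _ fun j =>
      ((measurable_pi_apply j).comp measurable_rep).add_const _)
  have hpm : Measurable fun z : Fin d → ℝ => proj (ε • z) :=
    measurable_proj.comp (measurable_const_smul ε)
  refine Measure.ext_of_lintegral _ fun g hg => ?_
  rw [noiseLaw, lintegral_withDensity_eq_lintegral_mul _ hper hg, volume_eq_projMeasure,
    lintegral_projMeasure (hper.mul hg), lintegral_map hg hpm,
    lintegral_kernelMeasure (g := fun z => g (proj (ε • z))) hK (hg.comp hpm)]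
  have h1 : ∫⁻ y in halfOpenCube d, (periodized K ε * g) (proj y) =
      ∫⁻ y in halfOpenCube d, ∑' n : Fin d → ℤ,
        (fun y => ENNReal.ofReal (rescale K ε y) * g (proj y)) (fun j => y j + n j) := by
    refine setLIntegral_congr_fun measurableSet_halfOpenCube fun y hy => ?_
    simp only [Pi.mul_apply, periodized, rep_proj hy, proj_add_intCast, ENNReal.tsum_mul_right]
  rw [h1, ← lintegral_eq_tsum_cube (h := fun y => ENNReal.ofReal (rescale K ε y) * g (proj y))
    (hres.mul (hg.comp measurable_proj))]
  have h2 : ∀ y, ENNReal.ofReal (rescale K ε y) * g (proj y) =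
      ENNReal.ofReal (ε ^ d)⁻¹ * (ENNReal.ofReal (K (ε⁻¹ • y)) * g (proj y)) := by
    intro y
    rw [rescale, ENNReal.ofReal_mul (by positivity), mul_assoc]
  simp_rw [h2]
  have hm : Measurable fun y : Fin d → ℝ => ENNReal.ofReal (K (ε⁻¹ • y)) * g (proj y) := by
    refine Measurable.mul ?_ (hg.comp measurable_proj)
    exact (hK.comp (measurable_const_smul _)).ennreal_ofReal
  rw [lintegral_const_mul _ hm, ← lintegral_comp_smul hε hm]
  simp [smul_smul, hε.ne']

lemma lintegral_noiseLaw {K : (Fin d → ℝ) → ℝ} (hK : Measurable K) {ε : ℝ} (hε : 0 < ε)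
    {g : UnitAddTorus (Fin d) → ℝ≥0∞} (hg : Measurable g) :
    ∫⁻ x, g x ∂(noiseLaw K ε) = ∫⁻ z, g (proj (ε • z)) ∂(kernelMeasure K) := by
  rw [noiseLaw_eq_map hK hε]
  exact lintegral_map hg (measurable_proj.comp (measurable_const_smul ε))

lemma isProbabilityMeasure_noiseLaw {K : (Fin d → ℝ) → ℝ} (hK : IsDensity K) {ε : ℝ}
    (hε : 0 < ε) : IsProbabilityMeasure (noiseLaw K ε) := by
  have := isProbabilityMeasure_kernelMeasure hK
  rw [noiseLaw_eq_map hK.measurable hε]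
  exact Measure.isProbabilityMeasure_map
    (measurable_proj.comp (measurable_const_smul ε)).aemeasurable

end Noise

/-! ### The Markov operator of the chain -/

section Chain

variable {d : ℕ} {f : UnitAddTorus (Fin d) → UnitAddTorus (Fin d)}
  {ν : Measure (UnitAddTorus (Fin d))}

/-- The Markov operator `g ↦ 𝔼 g (f x + ζ)`. -/
def markovOp (f : UnitAddTorus (Fin d) → UnitAddTorus (Fin d))
    (ν : Measure (UnitAddTorus (Fin d))) (g : UnitAddTorus (Fin d) → ℝ≥0∞)
    (x : UnitAddTorus (Fin d)) : ℝ≥0∞ :=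
  ∫⁻ z, g (f x + z) ∂ν

lemma measurable_markovOp [SFinite ν] (hf : Measurable f) {g : UnitAddTorus (Fin d) → ℝ≥0∞}
    (hg : Measurable g) : Measurable (markovOp f ν g) := by
  have h : Measurable fun q : UnitAddTorus (Fin d) × UnitAddTorus (Fin d) => g (f q.1 + q.2) := by
    fun_prop
  exact h.lintegral_prod_right'

lemma measurable_markovOp_iterate [SFinite ν] (hf : Measurable f)
    {g : UnitAddTorus (Fin d) → ℝ≥0∞} (hg : Measurable g) (n : ℕ) :
    Measurable ((markovOp f ν)^[n] g) := by
  induction n with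
  | zero => exact hg
  | succ n ih =>
    rw [Function.iterate_succ_apply']
    exact measurable_markovOp hf ih

lemma lintegral_stepLaw [SFinite ν] (hf : Measurable f) {g : UnitAddTorus (Fin d) → ℝ≥0∞}
    (hg : Measurable g) (μ : Measure (UnitAddTorus (Fin d))) :
    ∫⁻ x, g x ∂(stepLaw f ν μ) = ∫⁻ x, markovOp f ν g x ∂μ := by
  have h : Measurable fun q : UnitAddTorus (Fin d) × UnitAddTorus (Fin d) => f q.1 + q.2 := by
    fun_prop
  rw [stepLaw, lintegral_map hg h, lintegral_prod (fun q => g (f q.1 + q.2)) (hg.comp h).aemeasurable]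
  rfl

/-- Duality between laws and test functions; statements about laws are transferred through it to
iterates of the operator. -/
lemma lintegral_chainLaw [SFinite ν] (hf : Measurable f) {g : UnitAddTorus (Fin d) → ℝ≥0∞}
    (hg : Measurable g) (μ : Measure (UnitAddTorus (Fin d))) (n : ℕ) :
    ∫⁻ x, g x ∂(chainLaw f ν μ n) = ∫⁻ x, (markovOp f ν)^[n] g x ∂μ := by
  induction n generalizing g with
  | zero => rfl
  | succ n ih =>
    rw [chainLaw, Function.iterate_succ_apply', lintegral_stepLaw hf hg, ← chainLaw,
      ih (measurable_markovOp hf hg)]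
    rfl

lemma chainLaw_add_steps (μ : Measure (UnitAddTorus (Fin d))) (m n : ℕ) :
    chainLaw f ν μ (m + n) = chainLaw f ν (chainLaw f ν μ n) m :=
  Function.iterate_add_apply _ m n μ

lemma chainLaw_apply [SFinite ν] (hf : Measurable f) {s : Set (UnitAddTorus (Fin d))}
    (hs : MeasurableSet s) (μ : Measure (UnitAddTorus (Fin d))) (n : ℕ) :
    chainLaw f ν μ n s = ∫⁻ x, (markovOp f ν)^[n] (s.indicator 1) x ∂μ := by
  rw [← lintegral_chainLaw hf (measurable_one.indicator hs), lintegral_indicator_one hs]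

/-- This permits working with partial lower bounds: a component of the law found at one time
survives as a component at all later times. -/
lemma chainLaw_mono [SFinite ν] (hf : Measurable f) {μ μ' : Measure (UnitAddTorus (Fin d))}
    (h : μ ≤ μ') (n : ℕ) : chainLaw f ν μ n ≤ chainLaw f ν μ' n := by
  refine Measure.le_iff.2 fun s hs => ?_
  rw [chainLaw_apply hf hs, chainLaw_apply hf hs]
  exact lintegral_mono' h le_rfl

lemma chainLaw_add [SFinite ν] (hf : Measurable f) (μ μ' : Measure (UnitAddTorus (Fin d)))
    (n : ℕ) : chainLaw f ν (μ + μ') n = chainLaw f ν μ n + chainLaw f ν μ' n := by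
  refine Measure.ext fun s hs => ?_
  rw [Measure.add_apply, chainLaw_apply hf hs, chainLaw_apply hf hs, chainLaw_apply hf hs,
    lintegral_add_measure]

lemma chainLaw_smul [SFinite ν] (hf : Measurable f) (c : ℝ≥0∞)
    (μ : Measure (UnitAddTorus (Fin d))) (n : ℕ) :
    chainLaw f ν (c • μ) n = c • chainLaw f ν μ n := by
  refine Measure.ext fun s hs => ?_
  rw [Measure.smul_apply, chainLaw_apply hf hs, chainLaw_apply hf hs, lintegral_smul_measure]

lemma markovOp_one [IsProbabilityMeasure ν] :
    markovOp f ν (fun _ => 1) = fun _ => 1 := by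
  funext x
  simp [markovOp]

lemma markovOp_const_iterate [IsProbabilityMeasure ν] (n : ℕ) :
    (markovOp f ν)^[n] (fun _ => 1) = fun _ => 1 :=
  Function.iterate_fixed markovOp_one n

lemma chainLaw_univ [IsProbabilityMeasure ν] (hf : Measurable f)
    (μ : Measure (UnitAddTorus (Fin d))) (n : ℕ) : chainLaw f ν μ n univ = μ univ := by
  have h : (univ : Set (UnitAddTorus (Fin d))).indicator (1 : UnitAddTorus (Fin d) → ℝ≥0∞) = fun _ => 1 := by
    funext x
    simp
  rw [chainLaw_apply hf MeasurableSet.univ, h, markovOp_const_iterate]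
  simp

instance : Measure.IsAddHaarMeasure (volume : Measure (UnitAddTorus (Fin d))) :=
  inferInstanceAs (Measure.IsAddHaarMeasure
    (Measure.pi fun _ : Fin d => (volume : Measure UnitAddCircle)))

/-- Stationarity: `f` preserves Haar measure, and so does translation by each value of the noise. -/
lemma chainLaw_volume [IsProbabilityMeasure ν] (hf : MeasurePreserving f volume volume) (n : ℕ) :
    chainLaw f ν volume n = volume := by
  refine Function.iterate_fixed (f := stepLaw f ν) ?_ n
  refine Measure.ext_of_lintegral _ fun g hg => ?_
  have hfm := hf.measurable
  rw [lintegral_stepLaw hfm hg]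
  simp only [markovOp]
  rw [lintegral_lintegral_swap (by fun_prop)]
  have h : ∀ z, ∫⁻ x, g (f x + z) = ∫⁻ x, g x := by
    intro z
    rw [hf.lintegral_comp (f := fun y => g (y + z)) (by fun_prop), lintegral_add_right_eq_self]
  simp [h]

lemma markovOp_affine [IsProbabilityMeasure ν] (a b : ℝ≥0∞)
    {u : UnitAddTorus (Fin d) → ℝ≥0∞} (hu : Measurable u) :
    markovOp f ν (fun x => a + b * u x) = fun x => a + b * markovOp f ν u x := by
  funext x
  have h : Measurable fun z => u (f x + z) := by fun_prop
  simp only [markovOp]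
  rw [lintegral_add_left measurable_const, lintegral_const_mul _ h]
  simp

lemma markovOp_affine_iterate [IsProbabilityMeasure ν] (hf : Measurable f) (a b : ℝ≥0∞)
    {u : UnitAddTorus (Fin d) → ℝ≥0∞} (hu : Measurable u) (n : ℕ) :
    (markovOp f ν)^[n] (fun x => a + b * u x) = fun x => a + b * (markovOp f ν)^[n] u x := by
  induction n with
  | zero => rfl
  | succ n ih =>
    rw [Function.iterate_succ_apply', ih,
      markovOp_affine a b (measurable_markovOp_iterate hf hu n)]
    simp only [Function.iterate_succ_apply']

lemma markovOp_add {u v : UnitAddTorus (Fin d) → ℝ≥0∞}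
    (hu : Measurable u) :
    markovOp f ν (fun x => u x + v x) = fun x => markovOp f ν u x + markovOp f ν v x := by
  funext x
  have h : Measurable fun z => u (f x + z) := by fun_prop
  exact lintegral_add_left h _

lemma markovOp_add_iterate [SFinite ν] (hf : Measurable f)
    {u v : UnitAddTorus (Fin d) → ℝ≥0∞} (hu : Measurable u) (n : ℕ) :
    (markovOp f ν)^[n] (fun x => u x + v x) =
      fun x => (markovOp f ν)^[n] u x + (markovOp f ν)^[n] v x := by
  induction n with
  | zero => rfl
  | succ n ih =>
    rw [Function.iterate_succ_apply', ih,
      markovOp_add (measurable_markovOp_iterate hf hu n)]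
    simp only [Function.iterate_succ_apply']

end Chain

/-! ### Convergence from a weak minorization -/

section Doeblin

variable {d : ℕ} {f : UnitAddTorus (Fin d) → UnitAddTorus (Fin d)}
  {ν : Measure (UnitAddTorus (Fin d))}

/-- A minorization by the uniform distribution, with an additive error of a quarter. -/
def Minorized (f : UnitAddTorus (Fin d) → UnitAddTorus (Fin d))
    (ν : Measure (UnitAddTorus (Fin d))) (N : ℕ) (c : NNReal) : Prop :=
  ∀ (x : UnitAddTorus (Fin d)) (g : UnitAddTorus (Fin d) → ℝ≥0∞), Measurable g → (∀ y, g y ≤ 1) →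
    c * ∫⁻ y, g y ≤ (markovOp f ν)^[N] g x + c / 4

/-- Apply the minorization to `u` at `y` and to `1 - u` at `x` and add. The left sides total `c` and
the two errors total `c / 2`, so a net gain of `c / 2` remains. -/
lemma Minorized.oscillation_le_of_le_one [IsProbabilityMeasure ν] (hf : Measurable f) {N : ℕ}
    {c ρ : NNReal} (hρ : ρ + c / 2 = 1) (h : Minorized f ν N c)
    {u : UnitAddTorus (Fin d) → ℝ≥0∞} (hu : Measurable u) (hu1 : ∀ y, u y ≤ 1)
    (x y : UnitAddTorus (Fin d)) :
    (markovOp f ν)^[N] u x ≤ (markovOp f ν)^[N] u y + ρ := by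
  have hv : Measurable fun y => 1 - u y := measurable_const.sub hu
  have h1 := h y u hu hu1
  have h2 := h x (fun y => 1 - u y) hv fun y => tsub_le_self
  have hsum : (fun y => u y + (1 - u y)) = fun _ => 1 := by
    funext z
    exact add_tsub_cancel_of_le (hu1 z)
  have h3 : (markovOp f ν)^[N] u x + (markovOp f ν)^[N] (fun y => 1 - u y) x = 1 := by
    have := congrFun (markovOp_add_iterate (ν := ν) (v := fun y => 1 - u y) hf hu N) x
    rw [hsum, markovOp_const_iterate] at this
    exact this.symm
  have h3y : (markovOp f ν)^[N] u y + (markovOp f ν)^[N] (fun y => 1 - u y) y = 1 := by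
    have := congrFun (markovOp_add_iterate (ν := ν) (v := fun y => 1 - u y) hf hu N) y
    rw [hsum, markovOp_const_iterate] at this
    exact this.symm
  have h4 : (∫⁻ y, u y) + ∫⁻ y, (1 - u y) = 1 := by
    rw [← lintegral_add_left hu]
    simp only [hsum]
    simp
  -- What remains is linear arithmetic in finite extended reals, carried out after lifting to
  -- `NNReal`.
  generalize ∫⁻ y, u y = a at *
  generalize ∫⁻ y, (1 - u y) = b at *
  generalize (markovOp f ν)^[N] u x = q at *
  generalize (markovOp f ν)^[N] u y = p at *
  generalize (markovOp f ν)^[N] (fun y => 1 - u y) x = q' at *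
  generalize (markovOp f ν)^[N] (fun y => 1 - u y) y = p' at *
  have key : ∀ s t : ℝ≥0∞, s + t = 1 → s ≠ ⊤ ∧ t ≠ ⊤ := fun s t hst =>
    ENNReal.add_ne_top.1 (hst ▸ ENNReal.one_ne_top)
  obtain ⟨ha, hb⟩ := key _ _ h4
  obtain ⟨hq, hq'⟩ := key _ _ h3
  obtain ⟨hp, -⟩ := key _ _ h3y
  lift a to NNReal using ha
  lift b to NNReal using hb
  lift q to NNReal using hq
  lift q' to NNReal using hq'
  lift p to NNReal using hp
  have h44 : ((c : ℝ≥0∞) / 4) = ((c / 4 : NNReal) : ℝ≥0∞) := by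
    rw [ENNReal.coe_div (by norm_num)]
    rfl
  rw [h44] at h1 h2
  norm_cast at *
  rw [← NNReal.coe_le_coe] at *
  rw [← NNReal.coe_inj] at *
  push_cast at *
  have : (c : ℝ) * a + c * b = c := by rw [← mul_add, h4, mul_one]
  linarith

/-- Induction on blocks of `N` steps: subtract the infimum and divide by `ρ ^ m` to return to a
function with values in `[0, 1]`. The division is why `ρ ≠ 0` is required. -/
lemma Minorized.oscillation_le [IsProbabilityMeasure ν] (hf : Measurable f) {N : ℕ}
    {c ρ : NNReal} (hρ : ρ + c / 2 = 1) (hρ0 : ρ ≠ 0) (h : Minorized f ν N c)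
    {g : UnitAddTorus (Fin d) → ℝ≥0∞} (hg : Measurable g) (hg1 : ∀ y, g y ≤ 1) (m : ℕ)
    (x y : UnitAddTorus (Fin d)) :
    (markovOp f ν)^[N * m] g x ≤ (markovOp f ν)^[N * m] g y + (ρ : ℝ≥0∞) ^ m := by
  induction m generalizing x y with
  | zero =>
    simp only [mul_zero, Function.iterate_zero, id_eq, pow_zero]
    exact (hg1 x).trans le_add_self
  | succ m ih =>
    have hhm := measurable_markovOp_iterate (ν := ν) hf hg (N * m)
    rw [Nat.mul_succ, add_comm, Function.iterate_add_apply]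
    set h₀ := (markovOp f ν)^[N * m] g with hh₀
    set a : ℝ≥0∞ := ⨅ z, h₀ z with ha
    have hρm : (ρ : ℝ≥0∞) ^ m ≠ 0 := pow_ne_zero _ (by simpa using hρ0)
    have hρm' : (ρ : ℝ≥0∞) ^ m ≠ ⊤ := ENNReal.pow_ne_top ENNReal.coe_ne_top
    have hle : ∀ z, h₀ z - a ≤ (ρ : ℝ≥0∞) ^ m := by
      intro z
      rw [tsub_le_iff_right, add_comm, ha, ENNReal.iInf_add]
      exact le_iInf fun w => ih z w
    set u : UnitAddTorus (Fin d) → ℝ≥0∞ := fun z => (h₀ z - a) / (ρ : ℝ≥0∞) ^ m with hu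
    have hum : Measurable u := (hhm.sub_const a).div_const _
    have hu1 : ∀ z, u z ≤ 1 := fun z =>
      (ENNReal.div_le_div_right (hle z) _).trans_eq (ENNReal.div_self hρm hρm')
    have hdec : h₀ = fun z => a + (ρ : ℝ≥0∞) ^ m * u z := by
      funext z
      rw [hu, ENNReal.mul_div_cancel hρm hρm']
      exact (add_tsub_cancel_of_le (iInf_le _ z)).symm
    rw [hdec, markovOp_affine_iterate hf _ _ hum]
    calc a + (ρ : ℝ≥0∞) ^ m * (markovOp f ν)^[N] u x
        ≤ a + (ρ : ℝ≥0∞) ^ m * ((markovOp f ν)^[N] u y + ρ) := by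
          gcongr
          exact h.oscillation_le_of_le_one hf hρ hum hu1 x y
      _ = _ := by rw [pow_succ]; ring

/-- A weak minorization of the `N`-step kernel gives geometric convergence in total variation. -/
theorem Minorized.tvDist_le [IsProbabilityMeasure ν] (hf : MeasurePreserving f volume volume)
    {N : ℕ} {c ρ : NNReal} (hρ : ρ + c / 2 = 1) (hρ0 : ρ ≠ 0) (h : Minorized f ν N c)
    (μ : Measure (UnitAddTorus (Fin d))) [IsProbabilityMeasure μ] (m : ℕ) :
    tvDist (chainLaw f ν μ (N * m)) volume ≤ (ρ : ℝ≥0∞) ^ m := by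
  -- Averaging the oscillation bound over both starting points compares any two initial laws; one of
  -- them is then taken stationary, in either order.
  have hcmp : ∀ (μ₁ μ₂ : Measure (UnitAddTorus (Fin d))) [IsProbabilityMeasure μ₁]
      [IsProbabilityMeasure μ₂] (s : Set (UnitAddTorus (Fin d))), MeasurableSet s →
      chainLaw f ν μ₁ (N * m) s ≤ chainLaw f ν μ₂ (N * m) s + (ρ : ℝ≥0∞) ^ m := by
    intro μ₁ μ₂ _ _ s hs
    have hg : Measurable (s.indicator (1 : UnitAddTorus (Fin d) → ℝ≥0∞)) :=
      measurable_one.indicator hs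
    have hg1 : ∀ y, s.indicator (1 : UnitAddTorus (Fin d) → ℝ≥0∞) y ≤ 1 := fun y =>
      indicator_le_self' (fun _ _ => zero_le) y
    have hm := measurable_markovOp_iterate (ν := ν) hf.measurable hg (N * m)
    rw [chainLaw_apply hf.measurable hs, chainLaw_apply hf.measurable hs]
    have h1 : ∀ y, ∫⁻ x, (markovOp f ν)^[N * m] (s.indicator 1) x ∂μ₁ ≤
        (markovOp f ν)^[N * m] (s.indicator 1) y + (ρ : ℝ≥0∞) ^ m := by
      intro y
      refine (lintegral_mono fun x =>
        h.oscillation_le hf.measurable hρ hρ0 hg hg1 m x y).trans_eq ?_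
      simp
    have h2 := lintegral_mono (μ := μ₂) h1
    rw [lintegral_const, measure_univ, mul_one, lintegral_add_left hm, lintegral_const,
      measure_univ, mul_one] at h2
    exact h2
  have hp1 : IsProbabilityMeasure (chainLaw f ν μ (N * m)) :=
    ⟨by rw [chainLaw_univ hf.measurable, measure_univ]⟩
  refine iSup₂_le fun s hs => ?_
  have h1 := hcmp μ volume s hs
  have h2 := hcmp volume μ s hs
  rw [chainLaw_volume hf] at h1 h2
  have hρm' : (ρ : ℝ≥0∞) ^ m ≠ ⊤ := ENNReal.pow_ne_top ENNReal.coe_ne_top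
  rw [ENNReal.ofReal_le_iff_le_toReal hρm', abs_le]
  have h3 := ENNReal.toReal_mono (ENNReal.add_ne_top.2 ⟨measure_ne_top _ _, hρm'⟩) h1
  have h4 := ENNReal.toReal_mono (ENNReal.add_ne_top.2 ⟨measure_ne_top _ _, hρm'⟩) h2
  rw [ENNReal.toReal_add (measure_ne_top _ _) hρm'] at h3 h4
  constructor <;> linarith

end Doeblin

/-! ### Geometry of the cells and branches -/

lemma IsAxisCube.measurableSet {d : ℕ} {Q : Set (Fin d → ℝ)} (hQ : IsAxisCube Q) :
    MeasurableSet Q := by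
  obtain ⟨a, l, I, hl, hI, rfl⟩ := hQ
  refine MeasurableSet.univ_pi fun j => ?_
  -- Each factor is an open interval together with some of its two endpoints.
  have h : I j = Ioo (a j) (a j + l) ∪ I j ∩ {a j, a j + l} := by
    ext t
    constructor
    · intro ht
      by_cases h' : t ∈ Ioo (a j) (a j + l)
      · exact Or.inl h'
      · refine Or.inr ⟨ht, ?_⟩
        have := (hI j).2 ht
        simp only [mem_Ioo, mem_Icc, not_and_or, not_lt] at this h'
        rcases h' with h' | h'
        · exact Or.inl (le_antisymm h' this.1)
        · exact Or.inr (le_antisymm this.2 h')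
    · rintro (ht | ht)
      · exact (hI j).1 ht
      · exact ht.1
  rw [h]
  exact measurableSet_Ioo.union ((Set.toFinite _).subset inter_subset_right).measurableSet

lemma IsAxisCube.volume_pos {d : ℕ} {Q : Set (Fin d → ℝ)} (hQ : IsAxisCube Q) :
    0 < volume Q := by
  obtain ⟨a, l, I, hl, hI, rfl⟩ := hQ
  refine lt_of_lt_of_le ?_ (measure_mono (Set.pi_mono fun j _ => (hI j).1))
  rw [Real.volume_pi_Ioo]
  simpa using ENNReal.pow_pos (ENNReal.ofReal_pos.2 hl) d

lemma volume_halfOpenCube (d : ℕ) : volume (halfOpenCube d) = 1 := by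
  rw [Real.volume_pi_Ico]
  simp

namespace PiecewiseAffine

variable {d M : ℕ} {B : PiecewiseAffine d M}

/-- The expansion factor of the `i`-th branch. -/
def expansion (B : PiecewiseAffine d M) (i : Fin M) : ℝ := (B.weight i ^ (1 / (d : ℝ)))⁻¹

lemma branch_eq (i : Fin M) (x : Fin d → ℝ) :
    B.branch i x = (B.expansion i • B.rot i) *ᵥ x + B.shift i := by
  rw [branch, expansion, Matrix.smul_mulVec]

lemma continuous_branch (i : Fin M) : Continuous (B.branch i) := by
  have h : Continuous fun x : Fin d → ℝ => B.rot i *ᵥ x :=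
    Continuous.matrix_mulVec continuous_const continuous_id
  exact (h.const_smul (B.expansion i)).add continuous_const

lemma measurable_branch (i : Fin M) : Measurable (B.branch i) :=
  (continuous_branch i).measurable

namespace IsBernoulli

lemma cell_subset (hB : B.IsBernoulli) (i : Fin M) : B.cell i ⊆ halfOpenCube d :=
  (subset_iUnion B.cell i).trans hB.cell_cover.subset

lemma measurableSet_cell (hB : B.IsBernoulli) (i : Fin M) : MeasurableSet (B.cell i) :=
  (hB.cell_cube i).measurableSet

lemma volume_cell (hB : B.IsBernoulli) (i : Fin M) :
    volume (B.cell i) = ENNReal.ofReal (B.weight i) := by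
  rw [weight, ENNReal.ofReal_toReal]
  exact ((measure_mono (hB.cell_subset i)).trans_lt
    (by rw [volume_halfOpenCube]; exact ENNReal.one_lt_top)).ne

lemma weight_pos (hB : B.IsBernoulli) (i : Fin M) : 0 < B.weight i := by
  have := (hB.cell_cube i).volume_pos
  rwa [hB.volume_cell, ENNReal.ofReal_pos] at this

lemma sum_weight (hB : B.IsBernoulli) : ∑ i, B.weight i = 1 := by
  have h := measure_iUnion (μ := volume) hB.cell_disjoint hB.measurableSet_cell
  rw [hB.cell_cover, volume_halfOpenCube, tsum_fintype] at h
  simp_rw [hB.volume_cell] at h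
  rw [← ENNReal.ofReal_sum_of_nonneg fun i _ => (hB.weight_pos i).le, eq_comm,
    ENNReal.ofReal_eq_one] at h
  exact h

lemma weight_lt_one (hB : B.IsBernoulli) (i : Fin M) : B.weight i < 1 := by
  have : Nontrivial (Fin M) := Fin.nontrivial_iff_two_le.2 hB.two_le
  obtain ⟨j, hj⟩ := exists_ne i
  rw [← hB.sum_weight]
  exact Finset.single_lt_sum hj (Finset.mem_univ _) (Finset.mem_univ _) (hB.weight_pos j)
    fun k _ _ => (hB.weight_pos k).le

lemma one_lt_expansion (hd : 1 ≤ d) (hB : B.IsBernoulli) (i : Fin M) : 1 < B.expansion i := by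
  refine (one_lt_inv₀ (Real.rpow_pos_of_pos (hB.weight_pos i) _)).2 ?_
  exact Real.rpow_lt_one (hB.weight_pos i).le (hB.weight_lt_one i) (by positivity)

lemma expansion_pow (hd : 1 ≤ d) (hB : B.IsBernoulli) (i : Fin M) :
    B.expansion i ^ d = (B.weight i)⁻¹ := by
  rw [expansion, inv_pow, one_div, Real.rpow_inv_natCast_pow (hB.weight_pos i).le (by omega)]

lemma abs_det_rot (hB : B.IsBernoulli) (i : Fin M) : |(B.rot i).det| = 1 := by
  have h := congrArg Matrix.det ((Matrix.mem_orthogonalGroup_iff _ _).1 (hB.rot_orthogonal i))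
  rw [Matrix.det_mul, Matrix.det_transpose, Matrix.det_one] at h
  rw [← sq_eq_sq₀ (abs_nonneg _) zero_le_one, sq_abs]
  linarith

/-- A branch multiplies Lebesgue measure by the reciprocal of its weight. -/
lemma map_branch_volume (hd : 1 ≤ d) (hB : B.IsBernoulli) (i : Fin M) :
    (volume : Measure (Fin d → ℝ)).map (B.branch i) = ENNReal.ofReal (B.weight i) • volume := by
  have hdet : |(B.expansion i • B.rot i).det| = (B.weight i)⁻¹ := by
    rw [Matrix.det_smul, Fintype.card_fin, abs_mul, hB.abs_det_rot, mul_one, hB.expansion_pow hd,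
      abs_of_pos (inv_pos.2 (hB.weight_pos i))]
  have hne : (B.expansion i • B.rot i).det ≠ 0 := by
    intro h
    rw [h, abs_zero] at hdet
    exact (inv_pos.2 (hB.weight_pos i)).ne hdet
  have hlin := Real.map_matrix_volume_pi_eq_smul_volume_pi hne
  rw [abs_inv, hdet, inv_inv] at hlin
  have hcomp : B.branch i =
      (fun y => y + B.shift i) ∘ Matrix.toLin' (B.expansion i • B.rot i) := by
    funext x
    simp [branch_eq, Matrix.smul_mulVec]
  have hm : Measurable (Matrix.toLin' (B.expansion i • B.rot i)) :=
    (LinearMap.continuous_of_finiteDimensional _).measurable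
  rw [hcomp, ← Measure.map_map (measurable_add_const _) hm, hlin, Measure.map_smul,
    map_add_right_eq_self]

lemma setLIntegral_branch (hd : 1 ≤ d) (hB : B.IsBernoulli) (i : Fin M) {A : Set (Fin d → ℝ)}
    (hA : MeasurableSet A) {h : (Fin d → ℝ) → ℝ≥0∞} (hh : Measurable h) :
    ∫⁻ a in B.branch i ⁻¹' A, h (B.branch i a) = ENNReal.ofReal (B.weight i) * ∫⁻ y in A, h y := by
  rw [← setLIntegral_map hA hh (measurable_branch i), hB.map_branch_volume hd,
    Measure.restrict_smul, lintegral_smul_measure, smul_eq_mul]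

lemma branch_injective (hd : 1 ≤ d) (hB : B.IsBernoulli) (i : Fin M) :
    Function.Injective (B.branch i) := by
  intro x y hxy
  rw [branch_eq, branch_eq, add_left_inj, Matrix.smul_mulVec, Matrix.smul_mulVec] at hxy
  have h1 := smul_right_injective _ (zero_lt_one.trans (hB.one_lt_expansion hd i)).ne' hxy
  have h2 := congrArg (fun v => (B.rot i)ᵀ *ᵥ v) h1
  simpa [Matrix.mulVec_mulVec, (Matrix.mem_orthogonalGroup_iff' _ _).1 (hB.rot_orthogonal i)] using h2

lemma map_proj_of_mem (hB : B.IsBernoulli) {i : Fin M} {a : Fin d → ℝ} (ha : a ∈ B.cell i) :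
    B.map (proj a) = proj (B.branch i a) := by
  rw [map, rep_proj (hB.cell_subset i ha), Finset.sum_eq_single i, indicator_of_mem ha]
  · intro j _ hj
    exact indicator_of_notMem (fun h => Set.disjoint_left.1 (hB.cell_disjoint hj) h ha) _
  · simp

/-- The open cube is covered by the image of each cell. -/
lemma branch_preimage_openCube (hd : 1 ≤ d) (hB : B.IsBernoulli) (i : Fin M) :
    B.branch i ⁻¹' openCube d ⊆ B.cell i := by
  intro x hx
  -- Surjectivity on the torus gives a cell point with the same projected image. One image lies in
  -- the closed cube and the other in the open cube, so they agree in `ℝᵈ`, and injectivity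
  -- identifies the points.
  obtain ⟨z, ⟨y, hy, rfl⟩, hyx⟩ := (hB.branch_bijOn i).surjOn (mem_univ (proj (B.branch i x)))
  rw [torusBranch, rep_proj (hB.cell_subset i hy)] at hyx
  have := hB.branch_injective hd i (eq_of_proj_eq (hB.branch_mapsTo i hy) hx hyx)
  exact this ▸ hy

/-- The preimage is open and lies in the half-open cube, hence in its interior. -/
lemma branch_preimage_openCube' (hd : 1 ≤ d) (hB : B.IsBernoulli) (i : Fin M) :
    B.branch i ⁻¹' openCube d ⊆ openCube d := by
  have h1 : IsOpen (B.branch i ⁻¹' openCube d) :=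
    (isOpen_set_pi finite_univ fun _ _ => isOpen_Ioo).preimage (continuous_branch i)
  have h2 := interior_maximal ((hB.branch_preimage_openCube hd i).trans (hB.cell_subset i)) h1
  rw [interior_pi_set finite_univ] at h2
  simpa only [interior_Ico] using h2

lemma iUnion_closure_cell (hB : B.IsBernoulli) : ⋃ i, closure (B.cell i) = closedCube d := by
  rw [← closure_iUnion_of_finite, hB.cell_cover, closure_pi_set]
  simp

lemma branch_mapsTo_closure (hB : B.IsBernoulli) (i : Fin M) :
    MapsTo (B.branch i) (closure (B.cell i)) (closedCube d) := by
  have h := (hB.branch_mapsTo i).closure (continuous_branch i)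
  rwa [(isClosed_set_pi fun _ _ => isClosed_Icc).closure_eq] at h

lemma measurable_map (hB : B.IsBernoulli) : Measurable B.map := by
  refine measurable_proj.comp ?_
  exact Finset.measurable_fun_sum _ fun i _ =>
    ((measurable_branch i).indicator (hB.measurableSet_cell i)).comp measurable_rep

lemma volume_closedCube_eq : (volume.restrict (closedCube d) : Measure (Fin d → ℝ)) =
    volume.restrict (halfOpenCube d) := by
  rw [closedCube, Set.pi_univ_Icc]
  exact (Measure.restrict_congr_set Measure.univ_pi_Ico_ae_eq_Icc).symm

/-- The map preserves Lebesgue measure on the torus. -/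
lemma measurePreserving_map (hd : 1 ≤ d) (hB : B.IsBernoulli) :
    MeasurePreserving B.map volume volume := by
  refine ⟨hB.measurable_map, ?_⟩
  have hmp := Measure.isProbabilityMeasure_map (μ := (volume : Measure (UnitAddTorus (Fin d))))
    hB.measurable_map.aemeasurable
  -- Between probability measures an inequality is an equality. This allows each cell to be enlarged
  -- to the full preimage of the closed cube, after which the weights sum to one.
  refine Measure.eq_of_le_of_measure_univ_eq ?_ (by simp)
  refine Measure.le_iff.2 fun s hs => ?_
  have hg : Measurable (s.indicator (1 : UnitAddTorus (Fin d) → ℝ≥0∞)) :=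
    measurable_one.indicator hs
  rw [← lintegral_indicator_one hs, lintegral_map hg hB.measurable_map,
    ← lintegral_indicator_one hs]
  set g := s.indicator (1 : UnitAddTorus (Fin d) → ℝ≥0∞)
  rw [volume_eq_projMeasure, lintegral_projMeasure (g := fun x => g (B.map x)) (hg.comp hB.measurable_map),
    lintegral_projMeasure hg]
  have hcov : halfOpenCube d = ⋃ i, B.cell i := hB.cell_cover.symm
  conv_lhs => rw [hcov]
  rw [lintegral_iUnion hB.measurableSet_cell hB.cell_disjoint, tsum_fintype]
  have hle : ∀ i, ∫⁻ a in B.cell i, g (B.map (proj a)) ≤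
      ENNReal.ofReal (B.weight i) * ∫⁻ y in halfOpenCube d, g (proj y) := by
    intro i
    rw [setLIntegral_congr_fun (hB.measurableSet_cell i)
      (g := fun a => g (proj (B.branch i a))) fun a ha => by simp only [hB.map_proj_of_mem ha]]
    refine (lintegral_mono_set (t := B.branch i ⁻¹' closedCube d)
      fun a ha => hB.branch_mapsTo i ha).trans_eq ?_
    rw [hB.setLIntegral_branch hd i (h := fun y => g (proj y))
      (MeasurableSet.univ_pi fun _ => measurableSet_Icc) (hg.comp measurable_proj),
      volume_closedCube_eq]
  refine (Finset.sum_le_sum fun i _ => hle i).trans_eq ?_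
  rw [← Finset.sum_mul, ← ENNReal.ofReal_sum_of_nonneg fun i _ => (hB.weight_pos i).le,
    hB.sum_weight, ENNReal.ofReal_one, one_mul]

end IsBernoulli

end PiecewiseAffine

/-! ### Words and their cubes -/

/-- The unit cube with a layer of width `η` removed along its boundary. -/
def shrunkCube (d : ℕ) (η : ℝ) : Set (Fin d → ℝ) := Set.pi univ fun _ => Icc η (1 - η)

lemma measurableSet_shrunkCube (d : ℕ) (η : ℝ) : MeasurableSet (shrunkCube d η) :=
  MeasurableSet.univ_pi fun _ => measurableSet_Icc

lemma shrunkCube_subset_openCube {d : ℕ} {η : ℝ} (hη : 0 < η) :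
    shrunkCube d η ⊆ openCube d := fun x hx j hj => by
  have h := hx j hj
  exact ⟨hη.trans_le h.1, by linarith [h.2]⟩

lemma projMeasure_mono {d : ℕ} {A A' : Set (Fin d → ℝ)} (h : A ⊆ A') :
    projMeasure A ≤ projMeasure A' :=
  Measure.map_mono (Measure.restrict_mono h le_rfl) measurable_proj

lemma smul_measure_mono {α : Type*} [MeasurableSpace α] {a b : ℝ≥0∞} {μ μ' : Measure α}
    (h : a ≤ b) (hμ : μ ≤ μ') : a • μ ≤ b • μ' :=
  Measure.le_iff.2 fun s _ => mul_le_mul' h (hμ s)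

namespace PiecewiseAffine

variable {d M : ℕ} {B : PiecewiseAffine d M}

/-- The composition of the branches along a word, first letter first. -/
def wordMap (B : PiecewiseAffine d M) : List (Fin M) → (Fin d → ℝ) → Fin d → ℝ
  | [], x => x
  | i :: s, x => B.wordMap s (B.branch i x)

/-- The expansion factor of the composition along a word. -/
def wordExpansion (B : PiecewiseAffine d M) : List (Fin M) → ℝ
  | [] => 1
  | i :: s => B.expansion i * B.wordExpansion s

/-- The product of the weights along a word. -/
def wordWeight (B : PiecewiseAffine d M) : List (Fin M) → ℝ
  | [] => 1
  | i :: s => B.weight i * B.wordWeight s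

/-- The part of the cube of a word at relative distance at least `η` from its boundary. -/
def wordCube (B : PiecewiseAffine d M) (s : List (Fin M)) (η : ℝ) : Set (Fin d → ℝ) :=
  B.wordMap s ⁻¹' shrunkCube d η

lemma measurable_wordMap (s : List (Fin M)) : Measurable (B.wordMap s) := by
  induction s with
  | nil => exact measurable_id
  | cons i s ih => exact ih.comp (measurable_branch i)

lemma measurableSet_wordCube (s : List (Fin M)) (η : ℝ) : MeasurableSet (B.wordCube s η) :=
  measurable_wordMap s (measurableSet_shrunkCube d η)

namespace IsBernoulli

lemma wordExpansion_pos (hd : 1 ≤ d) (hB : B.IsBernoulli) (s : List (Fin M)) :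
    0 < B.wordExpansion s := by
  induction s with
  | nil => exact zero_lt_one
  | cons i s ih => exact mul_pos (zero_lt_one.trans (hB.one_lt_expansion hd i)) ih

lemma wordWeight_pos (hB : B.IsBernoulli) (s : List (Fin M)) : 0 < B.wordWeight s := by
  induction s with
  | nil => exact zero_lt_one
  | cons i s ih => exact mul_pos (hB.weight_pos i) ih

lemma wordWeight_eq (hd : 1 ≤ d) (hB : B.IsBernoulli) (s : List (Fin M)) :
    B.wordWeight s = (B.wordExpansion s ^ d)⁻¹ := by
  induction s with
  | nil => simp [wordWeight, wordExpansion]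
  | cons i s ih => rw [wordWeight, wordExpansion, mul_pow, hB.expansion_pow hd, ih, mul_inv, inv_inv]

/-- Together with `branch_preimage_openCube` this shows that points of a word's cube visit the
prescribed cells, although `wordCube` constrains only the final image. -/
lemma wordCube_subset_openCube (hd : 1 ≤ d) (hB : B.IsBernoulli) (s : List (Fin M)) {η : ℝ}
    (hη : 0 < η) : B.wordCube s η ⊆ openCube d := by
  induction s with
  | nil => exact shrunkCube_subset_openCube hη
  | cons i s ih => exact fun x hx => hB.branch_preimage_openCube' hd i (ih hx)

/-- An orthogonal matrix preserves the sum of squares, so a branch is an exact similarity for it.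
The norm of `Fin d → ℝ` is the sup norm, and converting between the two produces the factors `√d`
below. -/
lemma sum_sq_branch_sub (hB : B.IsBernoulli) (i : Fin M) (x y : Fin d → ℝ) :
    ∑ j, (B.branch i x j - B.branch i y j) ^ 2 = B.expansion i ^ 2 * ∑ j, (x j - y j) ^ 2 := by
  have h1 : ∀ j, B.branch i x j - B.branch i y j = B.expansion i * (B.rot i *ᵥ (x - y)) j := by
    intro j
    simp only [branch_eq, Matrix.smul_mulVec, Matrix.mulVec_sub, Pi.add_apply, Pi.smul_apply,
      Pi.sub_apply, smul_eq_mul]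
    ring
  have h2 : ∑ j, (B.rot i *ᵥ (x - y)) j ^ 2 = ∑ j, (x j - y j) ^ 2 := by
    have : (B.rot i *ᵥ (x - y)) ⬝ᵥ (B.rot i *ᵥ (x - y)) = (x - y) ⬝ᵥ (x - y) := by
      rw [Matrix.dotProduct_mulVec, Matrix.vecMul_mulVec,
        (Matrix.mem_orthogonalGroup_iff' _ _).1 (hB.rot_orthogonal i), Matrix.vecMul_one]
    simpa only [dotProduct, ← sq, Pi.sub_apply] using this
  simp_rw [h1, mul_pow]
  rw [← Finset.mul_sum, h2]

lemma sum_sq_wordMap_sub (hB : B.IsBernoulli) (s : List (Fin M)) (x y : Fin d → ℝ) :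
    ∑ j, (B.wordMap s x j - B.wordMap s y j) ^ 2 =
      B.wordExpansion s ^ 2 * ∑ j, (x j - y j) ^ 2 := by
  induction s generalizing x y with
  | nil => simp [wordMap, wordExpansion]
  | cons i s ih =>
    rw [wordMap, wordMap, ih, hB.sum_sq_branch_sub, wordExpansion]
    ring

lemma sum_sq_le_of_norm_le {x : Fin d → ℝ} {δ : ℝ} (h : ‖x‖ ≤ δ) : ∑ j, x j ^ 2 ≤ d * δ ^ 2 := by
  have h1 : ∀ j ∈ (Finset.univ : Finset (Fin d)), x j ^ 2 ≤ δ ^ 2 := fun j _ =>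
    sq_le_sq.2 (((norm_le_pi_norm x j).trans h).trans (le_abs_self δ))
  simpa using Finset.sum_le_card_nsmul _ _ _ h1

lemma abs_wordMap_sub_le (hd : 1 ≤ d) (hB : B.IsBernoulli) (s : List (Fin M))
    {x y : Fin d → ℝ} {δ : ℝ} (h : ‖x - y‖ ≤ δ) (j : Fin d) :
    |B.wordMap s x j - B.wordMap s y j| ≤ B.wordExpansion s * (Real.sqrt d * δ) := by
  have hδ : 0 ≤ δ := (norm_nonneg _).trans h
  have hL := hB.wordExpansion_pos hd s
  refine abs_le_of_sq_le_sq ?_ (by positivity)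
  calc (B.wordMap s x j - B.wordMap s y j) ^ 2
      ≤ ∑ j, (B.wordMap s x j - B.wordMap s y j) ^ 2 :=
        Finset.single_le_sum (f := fun j => (B.wordMap s x j - B.wordMap s y j) ^ 2)
          (fun _ _ => sq_nonneg _) (Finset.mem_univ j)
    _ = B.wordExpansion s ^ 2 * ∑ j, (x j - y j) ^ 2 := hB.sum_sq_wordMap_sub s x y
    _ ≤ B.wordExpansion s ^ 2 * (d * δ ^ 2) := by
        gcongr
        exact sum_sq_le_of_norm_le h
    _ = (B.wordExpansion s * (Real.sqrt d * δ)) ^ 2 := by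
        rw [mul_pow, mul_pow, Real.sq_sqrt (Nat.cast_nonneg d)]

/-- The images are at Euclidean distance at most `√d`, the diameter of the unit cube, and the
similarity divides this by its ratio. -/
lemma norm_sub_le_of_wordMap (hd : 1 ≤ d) (hB : B.IsBernoulli) (s : List (Fin M))
    {x y : Fin d → ℝ} (hx : B.wordMap s x ∈ closedCube d) (hy : B.wordMap s y ∈ closedCube d) :
    ‖x - y‖ ≤ Real.sqrt d / B.wordExpansion s := by
  have hL := hB.wordExpansion_pos hd s
  refine (pi_norm_le_iff_of_nonneg (by positivity)).2 fun j => ?_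
  rw [le_div_iff₀ hL, Real.norm_eq_abs, Pi.sub_apply]
  refine abs_le_of_sq_le_sq' ?_ (by positivity) |>.2
  have hn : ‖B.wordMap s x - B.wordMap s y‖ ≤ 1 := by
    refine (pi_norm_le_iff_of_nonneg zero_le_one).2 fun k => ?_
    have h1 := hx k (mem_univ k)
    have h2 := hy k (mem_univ k)
    rw [Real.norm_eq_abs, Pi.sub_apply, abs_le]
    constructor <;> linarith [h1.1, h1.2, h2.1, h2.2]
  have h3 := sum_sq_le_of_norm_le hn
  simp only [Pi.sub_apply, hB.sum_sq_wordMap_sub s x y] at h3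
  have h4 := Finset.single_le_sum (f := fun j => (x j - y j) ^ 2)
          (fun _ _ => sq_nonneg _) (Finset.mem_univ j)
  rw [mul_pow, sq_abs, Real.sq_sqrt (Nat.cast_nonneg d)]
  nlinarith [sq_nonneg (B.wordExpansion s)]

/-- One step of the chain started from Lebesgue measure on the preimage of `A` under a branch. -/
lemma stepLaw_projMeasure_ge (hd : 1 ≤ d) (hB : B.IsBernoulli) {K : (Fin d → ℝ) → ℝ}
    (hK : IsDensity K) {ε : ℝ} (hε : 0 < ε) {r : ℝ} {A A' : Set (Fin d → ℝ)}
    (hA : MeasurableSet A) (hA' : MeasurableSet A') (hsub : A ⊆ openCube d)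
    (hAA' : ∀ u ∈ A', ∀ v, ‖v‖ ≤ ε * r → u - v ∈ A) (i : Fin M) :
    (ENNReal.ofReal (B.weight i) * kernelMeasure K (Metric.closedBall 0 r)) • projMeasure A' ≤
      stepLaw B.map (noiseLaw K ε) (projMeasure (B.branch i ⁻¹' A)) := by
  have := isProbabilityMeasure_noiseLaw hK hε
  have := isProbabilityMeasure_kernelMeasure hK
  refine Measure.le_iff.2 fun s hs => ?_
  have hg : Measurable (s.indicator (1 : UnitAddTorus (Fin d) → ℝ≥0∞)) :=
    measurable_one.indicator hs
  rw [Measure.smul_apply, smul_eq_mul, ← lintegral_indicator_one hs, ← lintegral_indicator_one hs]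
  set g := s.indicator (1 : UnitAddTorus (Fin d) → ℝ≥0∞)
  have hG : Measurable fun q : (Fin d → ℝ) × (Fin d → ℝ) => g (proj (q.1 + ε • q.2)) :=
    hg.comp (measurable_proj.comp (by fun_prop))
  rw [lintegral_stepLaw hB.measurable_map hg,
    lintegral_projMeasure (measurable_markovOp hB.measurable_map hg), lintegral_projMeasure hg]
  have h1 : ∫⁻ a in B.branch i ⁻¹' A, markovOp B.map (noiseLaw K ε) g (proj a) =
      ∫⁻ a in B.branch i ⁻¹' A, (fun y => ∫⁻ z, g (proj (y + ε • z)) ∂(kernelMeasure K))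
        (B.branch i a) := by
    refine setLIntegral_congr_fun (measurable_branch i hA) fun a ha => ?_
    have hac : a ∈ B.cell i := hB.branch_preimage_openCube hd i (hsub ha)
    simp only [markovOp, hB.map_proj_of_mem hac]
    rw [lintegral_noiseLaw hK.measurable hε (g := fun z => g (proj (B.branch i a) + z))
      (by fun_prop)]
    simp only [proj_add]
  rw [h1, hB.setLIntegral_branch hd i hA hG.lintegral_prod_right',
    lintegral_lintegral_swap hG.aemeasurable, mul_assoc]
  gcongr
  -- For each admissible value of the noise, translating `A` by `ε • z` still covers `A'`.
  have h2 : ∀ z ∈ Metric.closedBall (0 : Fin d → ℝ) r,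
      ∫⁻ u in A', g (proj u) ≤ ∫⁻ y in A, g (proj (y + ε • z)) := by
    intro z hz
    rw [← lintegral_indicator hA', ← lintegral_indicator hA,
      ← lintegral_add_right_eq_self _ (ε • z)]
    refine lintegral_mono fun y => ?_
    by_cases hy : y + ε • z ∈ A'
    · have hv : ‖ε • z‖ ≤ ε * r := by
        rw [norm_smul, Real.norm_of_nonneg hε.le]
        gcongr
        simpa using hz
      have := hAA' _ hy _ hv
      rw [add_sub_cancel_right] at this
      rw [indicator_of_mem hy, indicator_of_mem this]
    · rw [indicator_of_notMem hy]
      exact zero_le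
  calc kernelMeasure K (Metric.closedBall 0 r) * ∫⁻ u in A', g (proj u)
      = ∫⁻ _ in Metric.closedBall (0 : Fin d → ℝ) r, (∫⁻ u in A', g (proj u))
          ∂(kernelMeasure K) := by rw [setLIntegral_const, mul_comm]
    _ ≤ ∫⁻ z in Metric.closedBall (0 : Fin d → ℝ) r, (∫⁻ y in A, g (proj (y + ε • z)))
          ∂(kernelMeasure K) := setLIntegral_mono' measurableSet_closedBall h2
    _ ≤ _ := setLIntegral_le_lintegral _ _

/-- The chain started from Lebesgue measure on the cube of a word follows the word with positive
probability, and then has a uniform component on almost the whole torus. -/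
lemma chainLaw_wordCube_ge (hd : 1 ≤ d) (hB : B.IsBernoulli) {K : (Fin d → ℝ) → ℝ}
    (hK : IsDensity K) {b : ℝ} (hb : 0 < b)
    (htail : ∀ r, 0 < r → ENNReal.ofReal (1 - b / r) ≤ kernelMeasure K (Metric.closedBall 0 r))
    {lam mu : ℝ} (hmu : 1 < mu) (hlam : mu < lam) (hexp : ∀ i, lam ≤ B.expansion i)
    {ε : ℝ} (hε : 0 < ε) (s : List (Fin M)) {r η η' : ℝ} (hη : 0 < η) (hr : b / (1 - mu⁻¹) ≤ r)
    (hη' : η + Real.sqrt d / (lam - mu) * B.wordExpansion s * (ε * r) ≤ η') :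
    ENNReal.ofReal (B.wordWeight s * (1 - b / (1 - mu⁻¹) / r)) • projMeasure (shrunkCube d η') ≤
      chainLaw B.map (noiseLaw K ε) (projMeasure (B.wordCube s η)) s.length := by
  have hm1 : 0 < 1 - mu⁻¹ := sub_pos.2 (inv_lt_one_of_one_lt₀ hmu)
  -- The sum of `b * mu⁻¹ ^ k` over `k`; it satisfies `b + θ / mu = θ`, which makes the induction on
  -- the failure probability close.
  set θ := b / (1 - mu⁻¹) with hθ
  have hθ0 : 0 < θ := div_pos hb hm1
  have hθb : b + θ / mu = θ := by
    have h1 : mu - 1 ≠ 0 := (sub_pos.2 hmu).ne'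
    have h2 : 1 - mu⁻¹ = (mu - 1) / mu := by field_simp
    rw [hθ, h2]
    field_simp
    ring
  have := isProbabilityMeasure_noiseLaw hK hε
  have hl : 0 < lam - mu := sub_pos.2 hlam
  -- Passing to the tail of the word replaces the allowed noise `r` by `mu * r` and enlarges the
  -- margin `η` by the displacement just incurred.
  induction s generalizing r η with
  | nil =>
    have hr0 : 0 < r := hθ0.trans_le hr
    have h1 : ENNReal.ofReal (B.wordWeight [] * (1 - θ / r)) ≤ 1 := by
      rw [ENNReal.ofReal_le_one, wordWeight, one_mul]
      linarith [div_pos hθ0 hr0]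
    have h2 : η ≤ η' := by
      refine le_trans (le_add_of_nonneg_right ?_) hη'
      have := hB.wordExpansion_pos hd []
      positivity
    refine (smul_measure_mono h1 le_rfl).trans ?_
    rw [one_smul]
    refine projMeasure_mono fun x hx j hj => ?_
    have := hx j hj
    exact ⟨h2.trans this.1, this.2.trans (by linarith)⟩
  | cons i t ih =>
    have hr0 : 0 < r := hθ0.trans_le hr
    have hL := hB.wordExpansion_pos hd t
    -- A displacement of at most `ε * r` now is magnified by the expansion of the letters still to
    -- come.
    set η₁ := η + B.wordExpansion t * (Real.sqrt d * (ε * r)) with hη₁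
    have hη₁0 : 0 < η₁ := by positivity
    have hrmu : θ ≤ mu * r := hr.trans (le_mul_of_one_le_left hr0.le hmu.le)
    have hstep := hB.stepLaw_projMeasure_ge hd hK hε (r := r) (measurableSet_wordCube t η)
      (measurableSet_wordCube t η₁) (hB.wordCube_subset_openCube hd t hη) (by
        intro u hu v hv j hj
        have h1 := hu j hj
        have h2 := abs_le.1 (hB.abs_wordMap_sub_le hd t (x := u - v) (y := u) (δ := ε * r)
          (by simpa using hv) j)
        simp only [mem_Icc] at h1 ⊢
        constructor <;> linarith [h1.1, h1.2, h2.1, h2.2]) i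
    -- The geometric series in one step: `1 + mu / (lam - mu) = lam / (lam - mu)`, and `lam` is at
    -- most the expansion of the letter `i`.
    have hgeom : η₁ + Real.sqrt d / (lam - mu) * B.wordExpansion t * (ε * (mu * r)) ≤ η' := by
      refine le_trans (le_of_eq_of_le ?_ (add_le_add_right (mul_le_mul_of_nonneg_right
        (mul_le_mul_of_nonneg_left (mul_le_mul_of_nonneg_right (hexp i) hL.le)
          (by positivity)) (by positivity)) η)) hη'
      rw [hη₁]
      field_simp
      ring
    have hih := ih hη₁0 hgeom hrmu
    have hchain : chainLaw B.map (noiseLaw K ε) (projMeasure (B.wordCube (i :: t) η))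
        (i :: t).length = chainLaw B.map (noiseLaw K ε)
          (stepLaw B.map (noiseLaw K ε) (projMeasure (B.branch i ⁻¹' B.wordCube t η)))
          t.length := rfl
    rw [hchain]
    refine le_trans ?_ (chainLaw_mono hB.measurable_map hstep _)
    rw [chainLaw_smul hB.measurable_map]
    refine le_trans ?_ (smul_measure_mono le_rfl hih)
    rw [smul_smul]
    refine smul_measure_mono ?_ le_rfl
    have hw := hB.weight_pos i
    have hwt := hB.wordWeight_pos t
    -- `ENNReal.ofReal` truncates at zero, so multiplicativity needs this sign; it comes from `θ ≤
    -- r`.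
    have h0 : 0 ≤ 1 - θ / (mu * r) := by
      rw [sub_nonneg, div_le_one (by positivity)]
      exact hrmu
    calc ENNReal.ofReal (B.wordWeight (i :: t) * (1 - θ / r))
        ≤ ENNReal.ofReal (B.weight i * (1 - b / r) * (B.wordWeight t * (1 - θ / (mu * r)))) := by
          refine ENNReal.ofReal_le_ofReal ?_
          have h3 : 1 - θ / r ≤ (1 - b / r) * (1 - θ / (mu * r)) := by
            have h4 : θ / r = b / r + θ / (mu * r) := by
              rw [← div_div θ mu r, ← add_div, hθb]
            rw [h4]
            have : 0 ≤ b / r * (θ / (mu * r)) := by positivity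
            linarith
          have h5 := mul_le_mul_of_nonneg_left h3 (mul_pos hw hwt).le
          rw [wordWeight]
          linarith
      _ = ENNReal.ofReal (B.weight i) * ENNReal.ofReal (1 - b / r) *
            ENNReal.ofReal (B.wordWeight t * (1 - θ / (mu * r))) := by
          rw [ENNReal.ofReal_mul' (mul_nonneg hwt.le h0), ENNReal.ofReal_mul hw.le]
      _ ≤ _ := by
          gcongr
          exact htail r hr0

/-- Every point of the cube lies in the cube of a word with a prescribed expansion factor. -/
lemma exists_word (hd : 1 ≤ d) (hB : B.IsBernoulli) {lam Lam : ℝ} (hlam : 1 < lam)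
    (hexp : ∀ i, lam ≤ B.expansion i) (hexp' : ∀ i, B.expansion i ≤ Lam) (n : ℕ) {T : ℝ}
    (hT : 1 ≤ T) (hTn : T ≤ lam ^ n) {w : Fin d → ℝ} (hw : w ∈ closedCube d) :
    ∃ s : List (Fin M), s.length ≤ n ∧ B.wordMap s w ∈ closedCube d ∧
      T ≤ B.wordExpansion s ∧ B.wordExpansion s ≤ Lam * T := by
  have hM : 0 < M := zero_lt_two.trans_le hB.two_le
  have hLam : 1 ≤ Lam := (hlam.le.trans (hexp ⟨0, hM⟩)).trans (hexp' ⟨0, hM⟩)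
  induction n generalizing T w with
  | zero =>
    refine ⟨[], le_rfl, hw, by simpa [wordExpansion] using hTn, ?_⟩
    rw [wordExpansion]
    nlinarith
  | succ n ih =>
    have hw' := hw
    rw [← hB.iUnion_closure_cell, mem_iUnion] at hw'
    -- Closures of cells cover the closed cube, so a letter is available at boundary points too.
    obtain ⟨i, hi⟩ := hw'
    have hbw := hB.branch_mapsTo_closure i hi
    have he : 0 < B.expansion i := zero_lt_one.trans (hB.one_lt_expansion hd i)
    -- Stop at the first letter that reaches the target, overshooting by a factor of at most `Lam`;
    -- otherwise continue with the target divided by the expansion already gained.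
    by_cases hTi : T ≤ B.expansion i
    · refine ⟨[i], by simp, hbw, by simpa [wordExpansion] using hTi, ?_⟩
      simp only [wordExpansion, mul_one]
      nlinarith [hexp' i]
    · have h1 : 1 ≤ T / B.expansion i := by
        rw [le_div_iff₀ he]
        linarith
      have h2 : T / B.expansion i ≤ lam ^ n := by
        rw [div_le_iff₀ he]
        refine hTn.trans ?_
        rw [pow_succ]
        gcongr
        exact hexp i
      obtain ⟨s, hs, hsw, hsT, hsT'⟩ := ih h1 h2 hbw
      refine ⟨i :: s, by simpa using hs, hsw, ?_, ?_⟩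
      · rw [wordExpansion, ← div_le_iff₀' he]
        exact hsT
      · rw [wordExpansion]
        calc B.expansion i * B.wordExpansion s ≤ B.expansion i * (Lam * (T / B.expansion i)) := by
              gcongr
          _ = Lam * T := by field_simp

end IsBernoulli

end PiecewiseAffine

/-! ### The mixing time -/

section Mixing

variable {d M : ℕ} {B : PiecewiseAffine d M} {K : (Fin d → ℝ) → ℝ}

/-- One step of the chain from a point has a uniform component at scale `ε`. -/
lemma stepLaw_dirac_ge {f : UnitAddTorus (Fin d) → UnitAddTorus (Fin d)} (hf : Measurable f)
    (hK : IsDensity K) {ε : ℝ} (hε : 0 < ε) {c R : ℝ} (hc : ∀ z : Fin d → ℝ, ‖z‖ ≤ R → c ≤ K z)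
    {Q : Set (Fin d → ℝ)} (hQ : MeasurableSet Q) (x : UnitAddTorus (Fin d))
    (hQR : ∀ u ∈ Q, ‖u - rep (f x)‖ ≤ ε * R) :
    (ENNReal.ofReal c * ENNReal.ofReal (ε ^ d)⁻¹) • projMeasure Q ≤
      stepLaw f (noiseLaw K ε) (Measure.dirac x) := by
  have := isProbabilityMeasure_noiseLaw hK hε
  refine Measure.le_iff.2 fun s hs => ?_
  have hg : Measurable (s.indicator (1 : UnitAddTorus (Fin d) → ℝ≥0∞)) :=
    measurable_one.indicator hs
  rw [Measure.smul_apply, smul_eq_mul, ← lintegral_indicator_one hs, ← lintegral_indicator_one hs]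
  set g := s.indicator (1 : UnitAddTorus (Fin d) → ℝ≥0∞)
  have hgp : Measurable fun u : Fin d → ℝ => g (proj u) := hg.comp measurable_proj
  have hm : Measurable fun y => Q.indicator (fun u => g (proj u)) (y + rep (f x)) :=
    (hgp.indicator hQ).comp (measurable_add_const _)
  rw [lintegral_projMeasure hg, lintegral_stepLaw hf hg,
    lintegral_dirac' x (measurable_markovOp hf hg), markovOp,
    lintegral_noiseLaw hK.measurable hε (g := fun z => g (f x + z)) (by fun_prop),
    lintegral_kernelMeasure hK.measurable (g := fun z => g (f x + proj (ε • z)))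
      (hg.comp ((measurable_proj.comp (measurable_const_smul ε)).const_add _)),
    ← lintegral_indicator hQ, ← lintegral_add_right_eq_self _ (rep (f x)), mul_assoc,
    ← lintegral_comp_smul hε hm,
    ← lintegral_const_mul _ (show Measurable fun z : Fin d → ℝ =>
      Q.indicator (fun u => g (proj u)) (ε • z + rep (f x)) from
        hm.comp (measurable_const_smul ε))]
  refine lintegral_mono fun z => ?_
  -- In the variable `u = ε • z + rep (f x)`, membership in `Q` forces `‖z‖ ≤ R`, where the kernel
  -- is at least `c`.
  by_cases hz : ε • z + rep (f x) ∈ Q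
  · have h1 := hQR _ hz
    rw [add_sub_cancel_right, norm_smul, Real.norm_of_nonneg hε.le] at h1
    simp only [indicator_of_mem hz, proj_add, proj_rep, add_comm (f x)]
    gcongr
    exact hc z (le_of_mul_le_mul_left h1 hε)
  · simp only [indicator_of_notMem hz, mul_zero]
    exact zero_le

/-- Write `z` as its positive part minus its negative part, both with coordinates in `[0, R]`. The
extra `1` accounts for the half-open intervals. -/
lemma le_of_norm_le {R c : ℝ} (hc : ∀ x y : Fin d → ℝ, (∀ j, x j ∈ Ico 0 (R + 1)) →
    (∀ j, y j ∈ Ico 0 (R + 1)) → c ≤ K (x - y)) {z : Fin d → ℝ} (hz : ‖z‖ ≤ R) : c ≤ K z := by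
  have hj : ∀ j, |z j| ≤ R := fun j => (norm_le_pi_norm z j).trans hz
  have h := hc (fun j => max (z j) 0) (fun j => max (-z j) 0)
    (fun j => ⟨le_max_right _ _, max_lt (by linarith [le_abs_self (z j), hj j])
      (by linarith [abs_nonneg (z j), hj j])⟩)
    (fun j => ⟨le_max_right _ _, max_lt (by linarith [neg_le_abs (z j), hj j])
      (by linarith [abs_nonneg (z j), hj j])⟩)
  convert h using 2
  funext j
  simp only [Pi.sub_apply]
  rcases le_total (z j) 0 with h0 | h0
  · rw [max_eq_right h0, max_eq_left (by linarith)]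
    ring
  · rw [max_eq_left h0, max_eq_right (by linarith)]
    ring

lemma shrunkCube_subset_halfOpenCube {η : ℝ} (hη : 0 < η) :
    shrunkCube d η ⊆ halfOpenCube d :=
  (shrunkCube_subset_openCube hη).trans (Set.pi_mono fun _ _ => Ioo_subset_Ico_self)

/-- The layer removed from the unit cube has small measure. -/
lemma volume_halfOpenCube_diff_shrunkCube_le {η : ℝ} (hη : 0 < η) (hη' : 2 * η ≤ 1) :
    volume (halfOpenCube d \ shrunkCube d η) ≤ ENNReal.ofReal (2 * d * η) := by
  have hv : volume (shrunkCube d η) = ENNReal.ofReal ((1 - 2 * η) ^ d) := by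
    rw [shrunkCube, Set.pi_univ_Icc, Real.volume_Icc_pi]
    simp only [Finset.prod_const, Finset.card_univ, Fintype.card_fin]
    rw [← ENNReal.ofReal_pow (by linarith)]
    ring_nf
  rw [measure_sdiff (shrunkCube_subset_halfOpenCube hη)
    (measurableSet_shrunkCube d η).nullMeasurableSet (by rw [hv]; exact ENNReal.ofReal_ne_top),
    hv, volume_halfOpenCube, ← ENNReal.ofReal_one,
    ← ENNReal.ofReal_sub _ (pow_nonneg (by linarith) _)]
  refine ENNReal.ofReal_le_ofReal ?_
  -- Bernoulli's inequality for `(1 - 2 * η) ^ d`.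
  have := one_add_mul_le_pow (a := -(2 * η)) (by linarith) d
  rw [← sub_eq_add_neg 1 (2 * η)] at this
  linarith

/-- Stationary Lebesgue measure splits into the shrunken cube and the layer; the layer keeps its
mass under the chain, so it contributes at most that mass. This lets a uniform component on the
shrunken cube be carried through any number of further steps. -/
lemma lintegral_volume_le {f : UnitAddTorus (Fin d) → UnitAddTorus (Fin d)}
    {ν : Measure (UnitAddTorus (Fin d))} [IsProbabilityMeasure ν]
    (hf : MeasurePreserving f volume volume) {η : ℝ} (hη : 0 < η) (hη' : 2 * η ≤ 1)
    {g : UnitAddTorus (Fin d) → ℝ≥0∞} (hg1 : ∀ y, g y ≤ 1) (k : ℕ) :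
    ∫⁻ y, g y ≤ ∫⁻ y, g y ∂(chainLaw f ν (projMeasure (shrunkCube d η)) k) +
      ENNReal.ofReal (2 * d * η) := by
  have hdec : (volume : Measure (UnitAddTorus (Fin d))) =
      projMeasure (shrunkCube d η) + projMeasure (halfOpenCube d \ shrunkCube d η) := by
    rw [volume_eq_projMeasure, projMeasure, projMeasure, projMeasure,
      ← Measure.map_add _ _ measurable_proj]
    conv_lhs => rw [← Measure.restrict_inter_add_sdiff _ (measurableSet_shrunkCube d η),
      inter_eq_right.2 (shrunkCube_subset_halfOpenCube hη)]
  conv_lhs => rw [← chainLaw_volume (ν := ν) hf k, hdec, chainLaw_add hf.measurable,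
    lintegral_add_measure]
  gcongr
  refine (lintegral_mono hg1).trans ?_
  rw [lintegral_one, chainLaw_univ hf.measurable, projMeasure_univ]
  exact volume_halfOpenCube_diff_shrunkCube_le hη hη'

namespace PiecewiseAffine.IsBernoulli

/-- The uniform component of the chain started from a point, given a word that leads from the
scale of the noise to the unit scale. -/
lemma minorized_of_word (hd : 1 ≤ d) (hB : B.IsBernoulli) (hK : IsDensity K) {b : ℝ} (hb : 0 < b)
    (htail : ∀ r, 0 < r → ENNReal.ofReal (1 - b / r) ≤ kernelMeasure K (Metric.closedBall 0 r))
    {lam mu : ℝ} (hmu : 1 < mu) (hlam : mu < lam) (hexp : ∀ i, lam ≤ B.expansion i)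
    {ε : ℝ} (hε : 0 < ε) {c R L : ℝ} (hc0 : 0 ≤ c) (hc : ∀ z : Fin d → ℝ, ‖z‖ ≤ R → c ≤ K z)
    {r : ℝ} (hr : 2 * (b / (1 - mu⁻¹)) ≤ r) (hL : Real.sqrt d / (lam - mu) * L * r ≤ 1 / (16 * d))
    (x : UnitAddTorus (Fin d)) (s : List (Fin M))
    (hs : B.wordMap s (rep (B.map x)) ∈ closedCube d)
    (hsR : Real.sqrt d / B.wordExpansion s ≤ ε * R) (hsL : B.wordExpansion s * ε ≤ L) :
    ENNReal.ofReal (c / (2 * L ^ d)) • projMeasure (shrunkCube d (1 / (8 * d))) ≤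
      chainLaw B.map (noiseLaw K ε) (Measure.dirac x) (s.length + 1) := by
  have := isProbabilityMeasure_noiseLaw hK hε
  have hd0 : (0 : ℝ) < d := by exact_mod_cast hd
  have hm1 : 0 < 1 - mu⁻¹ := sub_pos.2 (inv_lt_one_of_one_lt₀ hmu)
  have hθ : 0 < b / (1 - mu⁻¹) := div_pos hb hm1
  have hW := hB.wordExpansion_pos hd s
  have hL0 : 0 < L := (mul_pos hW hε).trans_le hsL
  have hr0 : 0 < r := by linarith
  have hl : 0 < lam - mu := sub_pos.2 hlam
  have h16 : (0 : ℝ) < 1 / (16 * d) := by positivity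
  have hstep := stepLaw_dirac_ge hB.measurable_map hK hε hc
    (measurableSet_wordCube (B := B) s (1 / (16 * d))) x fun u hu =>
      (hB.norm_sub_le_of_wordMap hd s
        (fun j hj => Ioo_subset_Icc_self (shrunkCube_subset_openCube h16 hu j hj)) hs).trans hsR
  -- The final margin `1 / (8 * d)` is spent half on the initial margin and half on the accumulated
  -- noise.
  have hword := hB.chainLaw_wordCube_ge hd hK hb htail hmu hlam hexp hε s (η' := 1 / (8 * d)) h16
    (show b / (1 - mu⁻¹) ≤ r by linarith) (by
      have h1 : Real.sqrt d / (lam - mu) * B.wordExpansion s * (ε * r) ≤ 1 / (16 * d) := by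
        refine le_trans (le_of_eq_of_le ?_ (mul_le_mul_of_nonneg_right
          (mul_le_mul_of_nonneg_left hsL (by positivity : 0 ≤ Real.sqrt d / (lam - mu)))
          hr0.le)) hL
        ring
      have h2 : (1 : ℝ) / (8 * d) = 1 / (16 * d) + 1 / (16 * d) := by
        field_simp
        norm_num
      linarith)
  have hchain : chainLaw B.map (noiseLaw K ε) (Measure.dirac x) (s.length + 1) =
      chainLaw B.map (noiseLaw K ε) (stepLaw B.map (noiseLaw K ε) (Measure.dirac x)) s.length :=
    rfl
  rw [hchain]
  refine le_trans ?_ (chainLaw_mono hB.measurable_map hstep _)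
  rw [chainLaw_smul hB.measurable_map]
  refine le_trans ?_ (smul_measure_mono le_rfl hword)
  rw [smul_smul]
  refine smul_measure_mono ?_ le_rfl
  have hhalf : (1 : ℝ) / 2 ≤ 1 - b / (1 - mu⁻¹) / r := by
    have : b / (1 - mu⁻¹) / r ≤ 1 / 2 := by
      rw [div_le_iff₀ hr0]
      linarith
    linarith
  rw [← ENNReal.ofReal_mul hc0, ← ENNReal.ofReal_mul (by positivity)]
  refine ENNReal.ofReal_le_ofReal ?_
  -- The weight of the word is the inverse `d`-th power of its expansion, so it cancels the noise
  -- density `ε⁻ᵈ` up to a constant.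
  have h3 : (L ^ d)⁻¹ ≤ (ε ^ d)⁻¹ * B.wordWeight s := by
    rw [hB.wordWeight_eq hd, ← mul_inv, ← mul_pow, mul_comm ε]
    gcongr
  calc c / (2 * L ^ d) = c * (L ^ d)⁻¹ * (1 / 2) := by
        field_simp
    _ ≤ c * ((ε ^ d)⁻¹ * B.wordWeight s) * (1 - b / (1 - mu⁻¹) / r) := by
        have := (hB.wordWeight_pos s).le
        gcongr
    _ = _ := by ring

/-- The chain is minorized after a number of steps that is logarithmic in `ε`. -/
lemma exists_minorized (hd : 1 ≤ d) (hB : B.IsBernoulli) (hK : IsDensity K) {b : ℝ} (hb : 0 < b)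
    (htail : ∀ r, 0 < r → ENNReal.ofReal (1 - b / r) ≤ kernelMeasure K (Metric.closedBall 0 r))
    (hlow : ∀ η : ℝ, 0 < η → ∃ c : ℝ, 0 < c ∧ ∀ x y : Fin d → ℝ,
      (∀ j, x j ∈ Ico 0 η) → (∀ j, y j ∈ Ico 0 η) → c ≤ K (x - y)) :
    ∃ (lam τ : ℝ) (c : NNReal), 1 < lam ∧ 0 < τ ∧ 0 < c ∧ c ≤ 1 ∧ ∀ (ε : ℝ) (n : ℕ), 0 < ε → ε ≤ τ →
      τ / ε ≤ lam ^ n → Minorized B.map (noiseLaw K ε) (n + 1) c := by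
  have hM : Nonempty (Fin M) := ⟨⟨0, zero_lt_two.trans_le hB.two_le⟩⟩
  obtain ⟨i₀, hi₀⟩ := Finite.exists_min B.expansion
  obtain ⟨i₁, hi₁⟩ := Finite.exists_max B.expansion
  set lam := B.expansion i₀ with hlamdef
  set Lam := B.expansion i₁
  have hlam : 1 < lam := hB.one_lt_expansion hd i₀
  have hLam : 1 < Lam := hB.one_lt_expansion hd i₁
  have hd0 : (0 : ℝ) < d := by exact_mod_cast hd
  set mu := (1 + lam) / 2 with hmudef
  have hmu : 1 < mu := by linarith
  have hmulam : mu < lam := by linarith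
  have hl : 0 < lam - mu := sub_pos.2 hmulam
  have hm1 : 0 < 1 - mu⁻¹ := sub_pos.2 (inv_lt_one_of_one_lt₀ hmu)
  -- The word is followed with probability at least one half for this `r`. Then `L` makes the
  -- accumulated displacement exactly `1 / (16 * d)`, and `τ` absorbs the overshoot `Lam` of the
  -- word.
  set r := 2 * (b / (1 - mu⁻¹)) with hr
  have hr0 : 0 < r := mul_pos two_pos (div_pos hb hm1)
  have hsd : 0 < Real.sqrt d := Real.sqrt_pos.2 hd0
  set L := 1 / (16 * d) / (Real.sqrt d / (lam - mu) * r) with hLdef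
  have hL0 : 0 < L := by positivity
  have hL : Real.sqrt d / (lam - mu) * L * r = 1 / (16 * d) := by
    rw [hLdef]
    field_simp
  set τ := L / Lam with hτ
  have hτ0 : 0 < τ := by positivity
  obtain ⟨c, hc0, hc⟩ := hlow (Real.sqrt d / τ + 1) (by positivity)
  have hcK : ∀ z : Fin d → ℝ, ‖z‖ ≤ Real.sqrt d / τ → c ≤ K z := fun z hz => le_of_norm_le hc hz
  set c₁ : ℝ := c / (2 * L ^ d) with hc₁
  have hc₁0 : 0 < c₁ := by positivity
  -- Capping the constant at `1` keeps the contraction factor `1 - c / 2` positive.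
  refine ⟨lam, τ, min (Real.toNNReal c₁) 1, hlam, hτ0, lt_min (Real.toNNReal_pos.2 hc₁0) one_pos,
    min_le_right _ _, ?_⟩
  intro ε n hε hετ hn x g hg hg1
  have := isProbabilityMeasure_noiseLaw hK hε
  have hw : rep (B.map x) ∈ closedCube d := fun j hj => Ico_subset_Icc_self (rep_mem _ j hj)
  obtain ⟨s, hsn, hsw, hsT, hsT'⟩ := hB.exists_word hd hlam hi₀ hi₁ n
    ((one_le_div hε).2 hετ) hn hw
  have hW := hB.wordExpansion_pos hd s
  have hmin := hB.minorized_of_word hd hK hb htail hmu hmulam hi₀ hε hc0.le hcK hr.ge hL.le x s hsw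
    (by
      rw [div_le_iff₀ hW]
      calc Real.sqrt d = ε * (Real.sqrt d / τ) * (τ / ε) := by field_simp
        _ ≤ _ := by gcongr)
    (by
      calc B.wordExpansion s * ε ≤ Lam * (τ / ε) * ε := by gcongr
        _ = L := by rw [hτ]; field_simp)
  rw [← hc₁] at hmin
  -- The number of idle steps after the word, bringing all starting points to the common time `n +
  -- 1`.
  obtain ⟨k, hk⟩ := Nat.exists_eq_add_of_le' (Nat.succ_le_succ hsn)
  have hfinal : (markovOp B.map (noiseLaw K ε))^[n + 1] g x =
      ∫⁻ y, g y ∂(chainLaw B.map (noiseLaw K ε)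
        (chainLaw B.map (noiseLaw K ε) (Measure.dirac x) (s.length + 1)) k) := by
    rw [← chainLaw_add_steps, ← hk, lintegral_chainLaw hB.measurable_map hg,
      lintegral_dirac' x (measurable_markovOp_iterate hB.measurable_map hg _)]
  have h1 := chainLaw_mono (ν := noiseLaw K ε) hB.measurable_map hmin k
  rw [chainLaw_smul hB.measurable_map] at h1
  have h2 := lintegral_mono' h1 (le_refl g)
  rw [lintegral_smul_measure, smul_eq_mul, ← hfinal] at h2
  -- The mass bound for the removed layer, which becomes the error of a quarter in `Minorized`.
  have h8 : 2 * (d : ℝ) * (1 / (8 * d)) = 1 / 4 := by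
    field_simp
    norm_num
  have h3 := lintegral_volume_le (ν := noiseLaw K ε) (hB.measurePreserving_map hd)
    (η := 1 / (8 * d)) (by positivity) (by
      rw [mul_one_div, div_le_one (by positivity)]
      have : (1 : ℝ) ≤ d := by exact_mod_cast hd
      linarith) hg1 k
  rw [h8] at h3
  set I := ∫⁻ y, g y ∂(chainLaw B.map (noiseLaw K ε) (projMeasure (shrunkCube d (1 / (8 * d)))) k)
  set c₂ : NNReal := min (Real.toNNReal c₁) 1 with hc₂
  have h4 : ENNReal.ofReal (1 / 4) = 4⁻¹ := by
    rw [ENNReal.ofReal_div_of_pos (by norm_num)]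
    simp
  have h5 : (c₂ : ℝ≥0∞) ≤ ENNReal.ofReal c₁ := by
    rw [ENNReal.ofReal]
    exact_mod_cast min_le_left _ _
  calc (c₂ : ℝ≥0∞) * ∫⁻ y, g y ≤ c₂ * (I + ENNReal.ofReal (1 / 4)) := by gcongr
    _ = c₂ * I + c₂ / 4 := by rw [mul_add, h4, div_eq_mul_inv]
    _ ≤ ENNReal.ofReal c₁ * I + c₂ / 4 := by gcongr
    _ ≤ _ := by gcongr

/-- Logarithmic mixing for noise with a linear tail bound and a density that is locally bounded
below. -/
theorem mixingTime_le (hd : 1 ≤ d) (hB : B.IsBernoulli) (hK : IsDensity K) {b : ℝ} (hb : 0 < b)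
    (htail : ∀ r, 0 < r → ENNReal.ofReal (1 - b / r) ≤ kernelMeasure K (Metric.closedBall 0 r))
    (hlow : ∀ η : ℝ, 0 < η → ∃ c : ℝ, 0 < c ∧ ∀ x y : Fin d → ℝ,
      (∀ j, x j ∈ Ico 0 η) → (∀ j, y j ∈ Ico 0 η) → c ≤ K (x - y)) :
    ∃ C : ℝ, ∀ᶠ ε : ℝ in 𝓝[>] 0,
      ((mixingTime B.map (noiseLaw K ε) (1 / 2) : ℕ∞) : ℝ≥0∞)
        ≤ ENNReal.ofReal (C * |Real.log ε|) := by
  obtain ⟨lam, τ, c, hlam, hτ, hc0, hc1, hmin⟩ := hB.exists_minorized hd hK hb htail hlow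
  set ρ : NNReal := 1 - c / 2 with hρdef
  have hc2 : c / 2 ≤ 1 := by
    rw [div_le_iff₀ two_pos]
    exact hc1.trans (by norm_num)
  have hρ : ρ + c / 2 = 1 := tsub_add_cancel_of_le hc2
  have hρ1 : ρ < 1 := by
    rw [← hρ]
    exact lt_add_of_pos_right _ (half_pos hc0)
  have hρ0 : ρ ≠ 0 := by
    intro h
    rw [h, zero_add, div_eq_one_iff_eq two_ne_zero] at hρ
    rw [hρ] at hc1
    norm_num at hc1
  obtain ⟨m, hm⟩ := NNReal.exists_pow_lt_of_lt_one (show (0 : NNReal) < 1 / 2 by norm_num) hρ1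
  have hll : 0 < Real.log lam := Real.log_pos hlam
  refine ⟨(2 / Real.log lam + 2) * m, ?_⟩
  -- With `|log ε|` at least `1` and at least `|log τ|`, the rounding of `n`, the extra step and the
  -- constant `τ` are all absorbed into multiples of `|log ε|`.
  have hev : ∀ᶠ ε : ℝ in 𝓝[>] 0, Real.log ε ≤ -max 1 |Real.log τ| :=
    Real.tendsto_log_nhdsGT_zero.eventually_le_atBot _
  filter_upwards [hev, self_mem_nhdsWithin] with ε hlog hε
  have hε0 : 0 < ε := hε
  have h1 : Real.log ε ≤ -1 := hlog.trans (neg_le_neg (le_max_left _ _))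
  have h2 : Real.log ε ≤ -|Real.log τ| := hlog.trans (neg_le_neg (le_max_right _ _))
  have habs : |Real.log ε| = -Real.log ε := abs_of_nonpos (by linarith)
  have hετ : ε ≤ τ := by
    rw [← Real.log_le_log_iff hε0 hτ]
    linarith [neg_abs_le (Real.log τ)]
  set n := ⌈Real.log (τ / ε) / Real.log lam⌉₊ with hn
  have hT : 1 ≤ τ / ε := (one_le_div hε0).2 hετ
  have hnT : τ / ε ≤ lam ^ n := by
    rw [← Real.log_le_log_iff (by positivity) (by positivity), Real.log_pow, ← div_le_iff₀ hll]
    exact Nat.le_ceil _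
  have hN := hmin ε n hε0 hετ hnT
  have := isProbabilityMeasure_noiseLaw hK hε0
  have hmix : mixingTime B.map (noiseLaw K ε) (1 / 2) ≤ ((n + 1) * m : ℕ) := by
    refine sInf_le ⟨(n + 1) * m, fun μ hμ => ?_, rfl⟩
    refine (hN.tvDist_le (hB.measurePreserving_map hd) hρ hρ0 μ m).trans ?_
    have h3 : ENNReal.ofReal (1 / 2) = ((1 / 2 : NNReal) : ℝ≥0∞) := by
      rw [ENNReal.ofReal]
      congr 1
      ext
      simp
    rw [h3]
    exact_mod_cast hm.le
  refine (ENat.toENNReal_le.2 hmix).trans ?_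
  rw [ENat.toENNReal_coe, ← ENNReal.ofReal_natCast]
  refine ENNReal.ofReal_le_ofReal ?_
  have hnle : (n : ℝ) ≤ Real.log (τ / ε) / Real.log lam + 1 :=
    (Nat.ceil_lt_add_one (div_nonneg (Real.log_nonneg hT) hll.le)).le
  have hle : Real.log (τ / ε) ≤ 2 * |Real.log ε| := by
    rw [Real.log_div hτ.ne' hε0.ne', habs]
    linarith [le_abs_self (Real.log τ)]
  have h4 : Real.log (τ / ε) / Real.log lam ≤ 2 / Real.log lam * |Real.log ε| := by
    rw [div_mul_eq_mul_div]
    gcongr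
  push_cast
  calc ((n : ℝ) + 1) * m ≤ (2 / Real.log lam * |Real.log ε| + 2 * |Real.log ε|) * m := by
        refine mul_le_mul_of_nonneg_right ?_ (Nat.cast_nonneg m)
        linarith
    _ = _ := by ring

end PiecewiseAffine.IsBernoulli

end Mixing

/-! ### Tail bounds and lower bounds for the kernels -/

section Kernels

variable {d : ℕ} {K : (Fin d → ℝ) → ℝ}

lemma IsDensity.integrable (hK : IsDensity K) : Integrable K := by
  by_contra hn
  simpa [integral_undef hn] using hK.integral_eq_one

lemma kernelMeasure_apply (K : (Fin d → ℝ) → ℝ) {s : Set (Fin d → ℝ)} (hs : MeasurableSet s) :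
    kernelMeasure K s = ∫⁻ x in s, ENNReal.ofReal (K x) :=
  withDensity_apply _ hs

/-- Markov's inequality for a weight `w` on the set where `w` exceeds `r`. -/
lemma setLIntegral_le_of_weight (hK0 : ∀ x, 0 ≤ K x) {w : (Fin d → ℝ) → ℝ} (hw0 : ∀ x, 0 ≤ w x)
    (hw : Integrable fun x => w x * K x) {r : ℝ} (hr : 0 < r) {s : Set (Fin d → ℝ)}
    (hs : MeasurableSet s) (hsw : ∀ x ∈ s, r ≤ w x) :
    ∫⁻ x in s, ENNReal.ofReal (K x) ≤ ENNReal.ofReal ((∫ x, w x * K x) / r) := by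
  rw [← integral_div, ofReal_integral_eq_lintegral_ofReal (hw.div_const r)
    (ae_of_all _ fun x => div_nonneg (mul_nonneg (hw0 x) (hK0 x)) hr.le)]
  refine (setLIntegral_mono' hs fun x hx => ENNReal.ofReal_le_ofReal ?_).trans
    (setLIntegral_le_lintegral _ _)
  rw [le_div_iff₀ hr, mul_comm]
  exact mul_le_mul_of_nonneg_right (hsw x hx) (hK0 x)

lemma ofReal_one_sub_le_of_compl (hK : IsDensity K) {t : ℝ} (ht : 0 ≤ t) {s : Set (Fin d → ℝ)}
    (hs : MeasurableSet s) (h : kernelMeasure K sᶜ ≤ ENNReal.ofReal t) :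
    ENNReal.ofReal (1 - t) ≤ kernelMeasure K s := by
  have := isProbabilityMeasure_kernelMeasure hK
  rw [ENNReal.ofReal_sub _ ht, ENNReal.ofReal_one, tsub_le_iff_right,
    ← prob_add_prob_compl (μ := kernelMeasure K) hs]
  gcongr

/-- The first absolute moment of a coordinate under a product density. -/
lemma integral_abs_mul_prod {k : ℝ → ℝ} (hk : Integrable k) (hk1 : ∫ t, k t = 1)
    (hm : Integrable fun t => |t| * k t) (j : Fin d) :
    Integrable (fun x : Fin d → ℝ => |x j| * ∏ l, k (x l)) ∧
      ∫ x : Fin d → ℝ, |x j| * ∏ l, k (x l) = ∫ t, |t| * k t := by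
  -- Absorb `|x j|` into the `j`-th factor, so that the integrand is again a product.
  have heq : (fun x : Fin d → ℝ => |x j| * ∏ l, k (x l)) =
      fun x => ∏ l, (if l = j then fun t => |t| * k t else k) (x l) := by
    funext x
    have : ∀ l, (if l = j then fun t => |t| * k t else k) (x l) =
        (if l = j then |x l| else 1) * k (x l) := by
      intro l
      split_ifs <;> simp
    simp_rw [this]
    rw [Finset.prod_mul_distrib]
    simp
  rw [heq]
  constructor
  · refine Integrable.fintype_prod (μ := fun _ => volume)
      (f := fun l : Fin d => if l = j then fun t => |t| * k t else k) fun l => ?_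
    split_ifs
    · exact hm
    · exact hk
  · rw [integral_fintype_prod_volume_eq_prod
      (f := fun l : Fin d => if l = j then fun t => |t| * k t else k), Finset.prod_eq_single j]
    · simp
    · intro l _ hl
      simp [hl, hk1]
    · simp

lemma IsFactor.integrable {A : ℝ} {k : ℝ → ℝ} (h : IsFactor A k) : Integrable k := by
  by_contra hn
  simpa [integral_undef hn] using h.integral_eq_one

/-- The first absolute moment of a coordinate under a combination of product densities. -/
lemma integral_abs_mul_combination_le {n : ℕ} {b : ℕ → ℝ} {k : ℕ → ℝ → ℝ} {A : ℝ}
    (hK : IsDensity K) (hsum : ∀ x, K x = ∑ i ∈ Finset.Icc 1 n, b i * ∏ j, k i (x j))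
    (hfac : ∀ i ∈ Finset.Icc 1 n, 0 ≤ b i ∧ IsFactor A (k i)) (j : Fin d) :
    Integrable (fun x : Fin d → ℝ => |x j| * K x) ∧ ∫ x : Fin d → ℝ, |x j| * K x ≤ A := by
  have hprod : ∀ i ∈ Finset.Icc 1 n, Integrable fun x : Fin d → ℝ => ∏ l, k i (x l) := fun i hi =>
    Integrable.fintype_prod (μ := fun _ => volume) (f := fun _ : Fin d => k i)
      fun _ => (hfac i hi).2.integrable
  -- Compare total integrals. The factors `k i` may change sign, so they enter only through
  -- integrals that are linear in the combination.
  have hone : ∑ i ∈ Finset.Icc 1 n, b i = 1 := by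
    rw [← hK.integral_eq_one]
    simp_rw [hsum]
    rw [integral_finsetSum _ fun i hi => (hprod i hi).const_mul (b i)]
    refine Finset.sum_congr rfl fun i hi => ?_
    rw [integral_const_mul, integral_fintype_prod_volume_eq_prod (f := fun _ : Fin d => k i)]
    simp [(hfac i hi).2.integral_eq_one]
  have hm : ∀ i ∈ Finset.Icc 1 n, _ := fun i hi =>
    integral_abs_mul_prod (hfac i hi).2.integrable (hfac i hi).2.integral_eq_one
      (hfac i hi).2.moment_integrable j
  have heq : (fun x : Fin d → ℝ => |x j| * K x) =
      fun x => ∑ i ∈ Finset.Icc 1 n, b i * (|x j| * ∏ l, k i (x l)) := by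
    funext x
    rw [hsum, Finset.mul_sum]
    exact Finset.sum_congr rfl fun i _ => by ring
  rw [heq]
  refine ⟨integrable_finsetSum _ fun i hi => (hm i hi).1.const_mul (b i), ?_⟩
  rw [integral_finsetSum _ fun i hi => (hm i hi).1.const_mul (b i)]
  calc ∑ i ∈ Finset.Icc 1 n, ∫ x : Fin d → ℝ, b i * (|x j| * ∏ l, k i (x l))
      ≤ ∑ i ∈ Finset.Icc 1 n, b i * A := by
        refine Finset.sum_le_sum fun i hi => ?_
        rw [integral_const_mul, (hm i hi).2]
        exact mul_le_mul_of_nonneg_left (hfac i hi).2.moment_le (hfac i hi).1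
    _ = A := by rw [← Finset.sum_mul, hone, one_mul]

lemma measurableSet_coordinate_gt (j : Fin d) (r : ℝ) :
    MeasurableSet {x : Fin d → ℝ | r < |x j|} :=
  measurableSet_lt measurable_const (by fun_prop)

lemma compl_closedBall_subset {r : ℝ} (hr : 0 < r) :
    (Metric.closedBall (0 : Fin d → ℝ) r)ᶜ ⊆ ⋃ j, {x | r < |x j|} := by
  intro x hx
  by_contra hn
  refine hx ?_
  rw [mem_closedBall_zero_iff, pi_norm_le_iff_of_nonneg hr.le]
  intro j
  by_contra hj
  exact hn (mem_iUnion.2 ⟨j, not_le.1 hj⟩)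

/-- The linear tail bound passes to `L¹` limits of densities with bounded first moments. -/
lemma tail_of_tendsto (hd : 1 ≤ d) (hK : IsDensity K) {Kn : ℕ → (Fin d → ℝ) → ℝ} {A : ℝ}
    (hA : 0 < A) (hKn : ∀ n, 1 ≤ n → IsDensity (Kn n))
    (hlim : Tendsto (fun n => ∫⁻ x, ENNReal.ofReal |Kn n x - K x|) atTop (𝓝 0))
    (hmom : ∀ n, 1 ≤ n → ∀ j : Fin d, Integrable (fun x => |x j| * Kn n x) ∧
      ∫ x : Fin d → ℝ, |x j| * Kn n x ≤ A) :
    ∃ b, 0 < b ∧ ∀ r, 0 < r →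
      ENNReal.ofReal (1 - b / r) ≤ kernelMeasure K (Metric.closedBall 0 r) := by
  have hd0 : (0 : ℝ) < d := by exact_mod_cast hd
  refine ⟨d * A, by positivity, fun r hr => ?_⟩
  refine ofReal_one_sub_le_of_compl hK (by positivity) measurableSet_closedBall ?_
  have hj : ∀ j : Fin d, kernelMeasure K {x | r < |x j|} ≤ ENNReal.ofReal (A / r) := by
    intro j
    have hs := measurableSet_coordinate_gt j r
    rw [kernelMeasure_apply K hs]
    -- Markov's inequality for `Kn n` bounds the tail of `K` with an `L¹` error that vanishes in the
    -- limit.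
    refine ge_of_tendsto
      (f := fun n => ENNReal.ofReal (A / r) + ∫⁻ x, ENNReal.ofReal |Kn n x - K x|)
      (by simpa using hlim.const_add (ENNReal.ofReal (A / r))) ?_
    filter_upwards [eventually_ge_atTop 1] with n hn
    calc ∫⁻ x in {x | r < |x j|}, ENNReal.ofReal (K x)
        ≤ ∫⁻ x in {x : Fin d → ℝ | r < |x j|},
            (ENNReal.ofReal (Kn n x) + ENNReal.ofReal |Kn n x - K x|) := by
          refine lintegral_mono fun x => ?_
          rw [← ENNReal.ofReal_add ((hKn n hn).nonneg x) (abs_nonneg _)]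
          exact ENNReal.ofReal_le_ofReal (by linarith [neg_abs_le (Kn n x - K x)])
      _ = (∫⁻ x in {x : Fin d → ℝ | r < |x j|}, ENNReal.ofReal (Kn n x)) +
            ∫⁻ x in {x : Fin d → ℝ | r < |x j|}, ENNReal.ofReal |Kn n x - K x| :=
          lintegral_add_left (hKn n hn).measurable.ennreal_ofReal _
      _ ≤ _ := by
          refine add_le_add ?_ (setLIntegral_le_lintegral _ _)
          refine (setLIntegral_le_of_weight (hKn n hn).nonneg (w := fun x => |x j|)
            (fun x => abs_nonneg _) (hmom n hn j).1 hr hs fun x hx => le_of_lt hx).trans ?_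
          refine ENNReal.ofReal_le_ofReal ?_
          gcongr
          exact (hmom n hn j).2
  calc kernelMeasure K (Metric.closedBall 0 r)ᶜ
      ≤ kernelMeasure K (⋃ j, {x | r < |x j|}) := measure_mono (compl_closedBall_subset hr)
    _ ≤ ∑ j : Fin d, kernelMeasure K {x | r < |x j|} := measure_iUnion_fintype_le _ _
    _ ≤ ∑ _j : Fin d, ENNReal.ofReal (A / r) := Finset.sum_le_sum fun j _ => hj j
    _ = ENNReal.ofReal (d * A / r) := by
      rw [Finset.sum_const, Finset.card_univ, Fintype.card_fin, nsmul_eq_mul, mul_div_assoc,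
        ENNReal.ofReal_mul hd0.le, ENNReal.ofReal_natCast]

lemma tail_of_integrable_norm (hK : IsDensity K) (h : Integrable fun x => ‖x‖ * K x) :
    ∃ b, 0 < b ∧ ∀ r, 0 < r →
      ENNReal.ofReal (1 - b / r) ≤ kernelMeasure K (Metric.closedBall 0 r) := by
  have h0 : 0 ≤ ∫ x, ‖x‖ * K x :=
    integral_nonneg fun x => mul_nonneg (norm_nonneg _) (hK.nonneg x)
  -- Markov's inequality for the norm; adding `1` makes the constant positive at once.
  refine ⟨(∫ x, ‖x‖ * K x) + 1, by linarith, fun r hr => ?_⟩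
  refine ofReal_one_sub_le_of_compl hK (by positivity) measurableSet_closedBall ?_
  rw [kernelMeasure_apply K measurableSet_closedBall.compl]
  refine (setLIntegral_le_of_weight hK.nonneg (w := fun x => ‖x‖) (fun x => norm_nonneg x) h hr
    measurableSet_closedBall.compl fun x hx => ?_).trans (ENNReal.ofReal_le_ofReal ?_)
  · simp only [mem_compl_iff, mem_closedBall_zero_iff, not_le] at hx
    exact hx.le
  · gcongr
    linarith

/-- A positive continuous kernel is bounded below on bounded sets. -/
lemma exists_lower_of_continuous (hK : Continuous K) (hpos : ∀ x, 0 < K x) (η : ℝ) :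
    ∃ c : ℝ, 0 < c ∧ ∀ x y : Fin d → ℝ,
      (∀ j, x j ∈ Ico 0 η) → (∀ j, y j ∈ Ico 0 η) → c ≤ K (x - y) := by
  obtain ⟨z, -, hz⟩ := (isCompact_closedBall (0 : Fin d → ℝ) |η|).exists_isMinOn
    ⟨0, by simp⟩ hK.continuousOn
  refine ⟨K z, hpos z, fun x y hx hy => hz ?_⟩
  rw [mem_closedBall_zero_iff, pi_norm_le_iff_of_nonneg (abs_nonneg η)]
  intro j
  have h1 := hx j
  have h2 := hy j
  rw [mem_Ico] at h1 h2
  rw [Pi.sub_apply, Real.norm_eq_abs, abs_le]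
  constructor <;> linarith [h1.1, h1.2, h2.1, h2.2, le_abs_self η]

end Kernels

/-! ### Gaussian kernels -/

section Gaussian

variable {d : ℕ}

/-- The standard Gaussian density on `ℝᵈ`. -/
def stdGaussianDensity (y : Fin d → ℝ) : ℝ :=
  ∏ j, (Real.sqrt (2 * Real.pi))⁻¹ * Real.exp (-(1 / 2) * y j ^ 2)

lemma stdGaussianDensity_pos (y : Fin d → ℝ) : 0 < stdGaussianDensity y :=
  Finset.prod_pos fun j _ => by positivity

lemma continuous_stdGaussianDensity :
    Continuous (stdGaussianDensity : (Fin d → ℝ) → ℝ) := by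
  unfold stdGaussianDensity
  fun_prop

lemma integral_oneDimGaussian :
    ∫ t : ℝ, (Real.sqrt (2 * Real.pi))⁻¹ * Real.exp (-(1 / 2) * t ^ 2) = 1 := by
  rw [integral_const_mul, integral_gaussian, div_div_eq_mul_div, div_one, mul_comm Real.pi]
  exact inv_mul_cancel₀ (by positivity)

lemma integrable_oneDimGaussian :
    Integrable fun t : ℝ => (Real.sqrt (2 * Real.pi))⁻¹ * Real.exp (-(1 / 2) * t ^ 2) :=
  (integrable_exp_neg_mul_sq (by norm_num)).const_mul _

lemma integral_stdGaussianDensity : ∫ y : Fin d → ℝ, stdGaussianDensity y = 1 := by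
  unfold stdGaussianDensity
  rw [integral_fintype_prod_volume_eq_prod
    (f := fun _ : Fin d => fun t => (Real.sqrt (2 * Real.pi))⁻¹ * Real.exp (-(1 / 2) * t ^ 2))]
  simp only [integral_oneDimGaussian, Finset.prod_const_one]

/-- The sup norm is at most the sum of the absolute coordinates, whose moments reduce to one
dimension. -/
lemma integrable_norm_mul_stdGaussianDensity :
    Integrable fun y : Fin d → ℝ => ‖y‖ * stdGaussianDensity y := by
  have hm : Integrable fun t : ℝ =>
      |t| * ((Real.sqrt (2 * Real.pi))⁻¹ * Real.exp (-(1 / 2) * t ^ 2)) := by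
    have := ((integrable_mul_exp_neg_mul_sq (b := 1 / 2) (by norm_num)).abs).const_mul
      (Real.sqrt (2 * Real.pi))⁻¹
    refine this.congr (ae_of_all _ fun t => ?_)
    simp only [abs_mul, Real.abs_exp]
    ring
  have hsum : Integrable fun y : Fin d → ℝ => ∑ j, |y j| * stdGaussianDensity y :=
    integrable_finsetSum _ fun j _ =>
      (integral_abs_mul_prod integrable_oneDimGaussian integral_oneDimGaussian hm j).1
  refine hsum.mono' (continuous_norm.mul continuous_stdGaussianDensity).aestronglyMeasurable
    (ae_of_all _ fun y => ?_)
  have h0 := (stdGaussianDensity_pos y).le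
  rw [Real.norm_of_nonneg (by positivity), ← Finset.sum_mul]
  refine mul_le_mul_of_nonneg_right ?_ h0
  refine (pi_norm_le_iff_of_nonneg (Finset.sum_nonneg fun _ _ => abs_nonneg _)).2 fun j => ?_
  exact Finset.single_le_sum (f := fun j => |y j|) (fun _ _ => abs_nonneg _) (Finset.mem_univ j)

-- Nonnegative elements of a C⋆-algebra have the form `star C * C`; the opened scopes supply the
-- order and the norm.
open scoped MatrixOrder Matrix.Norms.L2Operator in
lemma exists_transpose_mul_self {S : Matrix (Fin d) (Fin d) ℝ} (hS : S.PosSemidef) :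
    ∃ C : Matrix (Fin d) (Fin d) ℝ, S = Cᵀ * C := by
  obtain ⟨C, hC⟩ := CStarAlgebra.nonneg_iff_eq_star_mul_self.1 hS.nonneg
  exact ⟨C, hC⟩

/-- A nondegenerate Gaussian density is a linear image of the standard one. -/
lemma exists_gaussianDensity_eq {S : Matrix (Fin d) (Fin d) ℝ} (hS : S.PosDef) :
    ∃ C : Matrix (Fin d) (Fin d) ℝ, C.det ≠ 0 ∧
      ∀ x, gaussianDensity S x = |C.det| * stdGaussianDensity (C *ᵥ x) := by
  obtain ⟨C, hC⟩ := exists_transpose_mul_self hS.inv.posSemidef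
  have hdet : S.det⁻¹ = C.det ^ 2 := by
    rw [← Ring.inverse_eq_inv', ← Matrix.det_nonsing_inv, hC, Matrix.det_mul,
      Matrix.det_transpose, sq]
  have hdS := hS.det_pos
  have hne : C.det ≠ 0 := by
    intro h
    rw [h] at hdet
    have := inv_pos.2 hdS
    rw [hdet] at this
    norm_num at this
  refine ⟨C, hne, fun x => ?_⟩
  have hquad : x ⬝ᵥ (S⁻¹ *ᵥ x) = ∑ j, (C *ᵥ x) j ^ 2 := by
    rw [hC, ← Matrix.mulVec_mulVec, Matrix.dotProduct_mulVec, Matrix.vecMul_transpose]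
    simp only [dotProduct, sq]
  have hconst : (Real.sqrt ((2 * Real.pi) ^ d * S.det))⁻¹ =
      |C.det| * (Real.sqrt (2 * Real.pi))⁻¹ ^ d := by
    rw [← inv_inv S.det, hdet, ← Real.sqrt_inv, mul_inv, inv_inv, mul_comm,
      Real.sqrt_mul (sq_nonneg _), Real.sqrt_sq_eq_abs, ← inv_pow]
    congr 1
    rw [← Real.sqrt_inv, Real.sqrt_eq_iff_mul_self_eq (by positivity) (by positivity), ← mul_pow,
      Real.mul_self_sqrt (by positivity)]
  rw [gaussianDensity, stdGaussianDensity, hconst, hquad, Finset.prod_mul_distrib,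
    ← Real.exp_sum, ← Finset.mul_sum]
  simp only [Finset.prod_const, Finset.card_univ, Fintype.card_fin]
  rw [mul_assoc]
  congr 3
  ring

lemma map_mulVec_volume {C : Matrix (Fin d) (Fin d) ℝ} (hC : C.det ≠ 0) :
    (volume : Measure (Fin d → ℝ)).map (fun x => C *ᵥ x) = ENNReal.ofReal |C.det⁻¹| • volume :=
  Real.map_matrix_volume_pi_eq_smul_volume_pi hC

lemma continuous_mulVec (C : Matrix (Fin d) (Fin d) ℝ) :
    Continuous fun x : Fin d → ℝ => C *ᵥ x :=
  Continuous.matrix_mulVec continuous_const continuous_id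

lemma gaussianDensity_pos {S : Matrix (Fin d) (Fin d) ℝ} (hS : S.PosDef) (x : Fin d → ℝ) :
    0 < gaussianDensity S x := by
  have := hS.det_pos
  unfold gaussianDensity
  positivity

lemma continuous_gaussianDensity {S : Matrix (Fin d) (Fin d) ℝ} (hS : S.PosDef) :
    Continuous (gaussianDensity S) := by
  obtain ⟨C, -, h⟩ := exists_gaussianDensity_eq hS
  rw [funext h]
  exact continuous_const.mul (continuous_stdGaussianDensity.comp (continuous_mulVec C))

lemma isDensity_gaussianDensity {S : Matrix (Fin d) (Fin d) ℝ} (hS : S.PosDef) :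
    IsDensity (gaussianDensity S) := by
  refine ⟨(continuous_gaussianDensity hS).measurable, fun x => (gaussianDensity_pos hS x).le, ?_⟩
  obtain ⟨C, hC, h⟩ := exists_gaussianDensity_eq hS
  simp_rw [h]
  rw [integral_const_mul, ← integral_map (φ := fun x : Fin d → ℝ => C *ᵥ x)
    (continuous_mulVec C).aemeasurable continuous_stdGaussianDensity.aestronglyMeasurable,
    map_mulVec_volume hC, integral_smul_measure, integral_stdGaussianDensity,
    ENNReal.toReal_ofReal (abs_nonneg _), abs_inv, smul_eq_mul, mul_one]
  exact mul_inv_cancel₀ (abs_ne_zero.2 hC)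

/-- Change variables to `y = C x`, where `‖x‖ = ‖C⁻¹ y‖` is at most a constant times `‖y‖`. -/
lemma integrable_norm_mul_gaussianDensity {S : Matrix (Fin d) (Fin d) ℝ} (hS : S.PosDef) :
    Integrable fun x => ‖x‖ * gaussianDensity S x := by
  obtain ⟨C, hC, h⟩ := exists_gaussianDensity_eq hS
  have hinv : ∀ x, C⁻¹ *ᵥ (C *ᵥ x) = x := by
    intro x
    rw [Matrix.mulVec_mulVec, Matrix.nonsing_inv_mul _ hC.isUnit, Matrix.one_mulVec]
  set L : (Fin d → ℝ) →L[ℝ] (Fin d → ℝ) := LinearMap.toContinuousLinearMap (Matrix.toLin' C⁻¹)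
  have hG : Integrable fun y : Fin d → ℝ => ‖C⁻¹ *ᵥ y‖ * stdGaussianDensity y := by
    refine (integrable_norm_mul_stdGaussianDensity.const_mul ‖L‖).mono'
      ((continuous_mulVec C⁻¹).norm.mul continuous_stdGaussianDensity).aestronglyMeasurable
      (ae_of_all _ fun y => ?_)
    have h0 := (stdGaussianDensity_pos y).le
    rw [Real.norm_of_nonneg (by positivity), ← mul_assoc]
    exact mul_le_mul_of_nonneg_right (L.le_opNorm y) h0
  have hmap : Integrable (fun y : Fin d → ℝ => ‖C⁻¹ *ᵥ y‖ * stdGaussianDensity y)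
      ((volume : Measure (Fin d → ℝ)).map fun x => C *ᵥ x) := by
    rw [map_mulVec_volume hC]
    exact hG.smul_measure ENNReal.ofReal_ne_top
  have hcomp := (hmap.comp_measurable (continuous_mulVec C).measurable).const_mul |C.det|
  refine hcomp.congr (ae_of_all _ fun x => ?_)
  simp only [Function.comp_apply, hinv, h]
  ring

end Gaussian

end TorusMixing

end

/-- Both kinds of noise satisfy the tail bound and the local lower bound required by
`mixingTime_le`: the Gaussian by its finite first moment, continuity and positivity, the separated
kernel by the uniform first moments of its approximants and its assumed lower bound. -/
theorem theorem1 {d M : ℕ} (hd : 1 ≤ d) (B : TorusMixing.PiecewiseAffine d M)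
    (K : (Fin d → ℝ) → ℝ)
    (h : TorusMixing.GaussianAssumption B K ∨ TorusMixing.SeparatedAssumption B K) :
    ∃ C : ℝ, ∀ᶠ ε : ℝ in 𝓝[>] 0,
      ((TorusMixing.mixingTime B.map (TorusMixing.noiseLaw K ε) (1 / 2) : ℕ∞) : ℝ≥0∞)
        ≤ ENNReal.ofReal (C * |Real.log ε|) := by
  rcases h with h | h
  · obtain ⟨S, hS, rfl⟩ := h.gaussian
    have hK := TorusMixing.isDensity_gaussianDensity hS
    obtain ⟨b, hb, htail⟩ := TorusMixing.tail_of_integrable_norm hK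
      (TorusMixing.integrable_norm_mul_gaussianDensity hS)
    exact h.toIsBernoulli.mixingTime_le hd hK hb htail fun η _ =>
      TorusMixing.exists_lower_of_continuous (TorusMixing.continuous_gaussianDensity hS)
        (TorusMixing.gaussianDensity_pos hS) η
  · obtain ⟨Kn, β, k, A, hA, hKn, hlim, hsum, hfac⟩ := h.separated
    obtain ⟨b, hb, htail⟩ := TorusMixing.tail_of_tendsto hd h.density hA hKn hlim fun n hn j =>
      TorusMixing.integral_abs_mul_combination_le (hKn n hn) (hsum n hn) (hfac n hn) j
    exact h.toIsBernoulli.mixingTime_le hd h.density hb htail h.lower
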